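/- Let $k$ be a field, $q\in k^{\times}$, $G$ a group, $V$ a finite-dimensional $k$-vector space with a linear action $v\mapsto{}^g v$ of $G$ (extended to $S(V)$ by algebra automorphisms), and $f\colon G\times G\to k^\times$ a normal $2$-cocycle. Let $A=S(V)\#_fG$ be the $k$-algebra that is free as a left $S(V)$-module with basis $(w_g)_{g\in G}$ and has product $(Pw_g)(Qw_h)=f(g,h)\,P\,{}^gQ\,w_{gh}$; $S(V)$ is identified with $S(V)w_1\subseteq A$. Let $H_q$ be the $k$-algebra generated by $D_1,D_2,\sigma^{\pm1}$ with relations $D_1D_2=D_2D_1$, $\sigma\sigma^{-1}=\sigma^{-1}\sigma=1$, $q\sigma D_i=D_i\sigma$ and, if $q$ is a primitive $l$-th root of unity with $l\ge 2$, also $D_1^l=D_2^l=0$; it is a Hopf algebra with $\Delta(D_1)=D_1\otimes\sigma+1\otimes D_1$, $\Delta(D_2)=D_2\otimes1+\sigma\otimes D_2$, $\Delta(\sigma)=\sigma\otimes\sigma$, $\epsilon(D_i)=0$, $\epsilon(\sigma)=1$. Let $\chi_\alpha\colon G\to k^\times$ be a group homomorphism, $\hat\alpha\colon V\to V$ a bijective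 $k[G]$-linear map, and $\alpha$ the automorphism of $A$ with $\alpha(v_1\cdots v_mw_g)=\hat\alpha(v_1)\cdots\hat\alpha(v_m)\chi_\alpha(g)w_g$. Let $s\colon H_q\otimes A\to A\otimes H_q$ be the associated transposition, $s(\sigma^iD_1^jD_2^m\otimes a)=\alpha^{j-m}(a)\otimes\sigma^iD_1^jD_2^m$. An $H_q$-module algebra structure on $(A,s)$ is a left $H_q$-module structure $\rho\colon H_q\otimes A\to A$, $\rho(h\otimes a)=h\cdot a$, such that, with $\tau$ the flip of $H_q\otimes H_q$ and $\mu$ the multiplication of $A$: $s$ is a left transposition (bijective and compatible with the bialgebra structure of $H_q$, with $\tau$ and with the algebra structure of $A$); $s\circ(H_q\otimes\rho)=(\rho\otimes H_q)\circ(H_q\otimes s)\circ(\tau\otimes A)$; $\mu\circ(\rho\otimes\rho)\circ(H_q\otimes s\otimes A)\circ(\Delta\otimes A\otimes A)=\rho\circ(H_q\otimes\mu)$; and $h\cdot1=\epsilon(h)1$ for all $h\in H_q$. Let $\hat\delta_1,\hat\delta_2\colon V\to A$ and $\hat\varsigma\colon V\to V$ be $k$-linear maps and $\chi_\varsigma\colon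 G\to k^\times$ a map. Assume that $\ker\hat\delta_1\ne\ker\hat\delta_2$ both have codimension $1$ in $V$, and that $x_1\in\ker\hat\delta_2\setminus\ker\hat\delta_1$ and $x_2\in\ker\hat\delta_1\setminus\ker\hat\delta_2$ satisfy $\hat\delta_i(x_i)=P_iw_{g_i}$ with $P_i\in S(V)$, $g_i\in G$. Let $\lambda_{ig},\omega_i,\nu_i\in k$ be determined by $${}^gx_i-\lambda_{ig}x_i\in\ker\hat\delta_i,\qquad\hat\varsigma(x_i)-\omega_ix_i\in\ker\hat\delta_i,\qquad\hat\alpha(x_i)-\nu_ix_i\in\ker\hat\delta_i .$$ Let $\varsigma\colon A\to A$ be the $k$-linear map with $\varsigma(v_1\cdots v_mw_g)=\hat\varsigma(v_1)\cdots\hat\varsigma(v_m)\chi_\varsigma(g)w_g$. **Theorem.** There is an $H_q$-module algebra structure on $(A,s)$ with $$\sigma\cdot v=\hat\varsigma(v),\quad\sigma\cdot w_g=\chi_\varsigma(g)w_g,\quad D_i\cdot v=\hat\delta_i(v),\quad D_i\cdot w_g=0\qquad(v\in V,\ g\in G,\ i\in\{1,2\})$$ if and only if the following ten conditions hold: 1.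 $\hat\varsigma$ is a bijective $k[G]$-linear map and $\chi_\varsigma$ is a group homomorphism; 2. $\hat\varsigma(v)={}^{g_1^{-1}}\hat\alpha(v)$ for all $v\in\ker\hat\delta_1$ and $\hat\varsigma(v)={}^{g_2}\hat\alpha(v)$ for all $v\in\ker\hat\delta_2$; 3. $g_1$ and $g_2$ belong to the center of $G$; 4. $\ker\hat\delta_1$ and $\ker\hat\delta_2$ are $G$-submodules of $V$; 5. ${}^gP_1=\lambda_{1g}\,\chi_\alpha^{-1}(g)\chi_\varsigma(g)f^{-1}(g,g_1)f(g_1,g)\,P_1$ for all $g\in G$; 6. ${}^gP_2=\lambda_{2g}\,\chi_\alpha(g)\chi_\varsigma^{-1}(g)f^{-1}(g,g_2)f(g_2,g)\,P_2$ for all $g\in G$; 7. $\hat\alpha(\ker\hat\delta_i)=\ker\hat\delta_i$ for $i\in\{1,2\}$; 8. $P_1\in\ker\delta_2$ and $P_2\in\ker\delta_1$, where $\delta_1,\delta_2\colon A\to A$ are the $k$-linear maps determined by $$\delta_1(v_1\cdots v_mw_g)=\sum_{j=1}^m\alpha(v_1\cdots v_{j-1})\,\hat\delta_1(v_j)\,\varsigma(v_{j+1}\cdots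 v_mw_g),$$ $$\delta_2(v_1\cdots v_mw_g)=\sum_{j=1}^m\varsigma\bigl(\alpha^{-1}(v_1\cdots v_{j-1})\bigr)\,\hat\delta_2(v_j)\,v_{j+1}\cdots v_mw_g$$ for all $m\ge0$, $v_1,\dots,v_m\in V$, $g\in G$; 9. $\varsigma(P_i)=q^{-1}\omega_i\chi_\varsigma^{-1}(g_i)P_i$ and $\alpha(P_i)=\nu_i\chi_\alpha^{-1}(g_i)P_i$ for $i\in\{1,2\}$; 10. if $q\ne1$ and $q^l=1$ with $l\ge1$, then $\delta_1^l=\delta_2^l=0$. Moreover, whenever conditions (2) and (7) hold, the formulas in (8) do define unique $k$-linear maps $\delta_1$ and $\delta_2$. -/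

import Mathlib

open TensorProduct

noncomputable section

/-! ### The bialgebra `H_q` -/

namespace HopfQ

/-- Generators `D₁, D₂, σ, σ⁻¹`. -/
inductive Gen : Type
  | D₁ | D₂ | sig | sigInv

section
variable {k : Type*} [Field k]

/-- The generator `x` in the free algebra. -/
abbrev gen (k : Type*) [Field k] (x : Gen) : FreeAlgebra k Gen := FreeAlgebra.ι k x

/-- The defining relations of `H_q`. The last two are present only if `q` is a primitive `l`-th
root of unity with `l ≥ 2`. -/
inductive Rel (q : kˣ) : FreeAlgebra k Gen → FreeAlgebra k Gen → Prop
  | comm : Rel q (gen k .D₁ * gen k .D₂) (gen k .D₂ * gen k .D₁)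
  | sig_inv : Rel q (gen k .sig * gen k .sigInv) 1
  | inv_sig : Rel q (gen k .sigInv * gen k .sig) 1
  | skew₁ : Rel q ((q : k) • (gen k .sig * gen k .D₁)) (gen k .D₁ * gen k .sig)
  | skew₂ : Rel q ((q : k) • (gen k .sig * gen k .D₂)) (gen k .D₂ * gen k .sig)
  | nil₁ (l : ℕ) (hl : 2 ≤ l) (hq : IsPrimitiveRoot (q : k) l) : Rel q (gen k .D₁ ^ l) 0
  | nil₂ (l : ℕ) (hl : 2 ≤ l) (hq : IsPrimitiveRoot (q : k) l) : Rel q (gen k .D₂ ^ l) 0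

end

end HopfQ

/-- The algebra `H_q`. -/
def Hq {k : Type*} [Field k] (q : kˣ) : Type _ := RingQuot (HopfQ.Rel q)

namespace Hq

variable {k : Type*} [Field k] (q : kˣ)

instance : Ring (Hq q) := inferInstanceAs (Ring (RingQuot (HopfQ.Rel q)))
instance : Algebra k (Hq q) := inferInstanceAs (Algebra k (RingQuot (HopfQ.Rel q)))

/-- The class of a generator in `H_q`. -/
def of (x : HopfQ.Gen) : Hq q := RingQuot.mkAlgHom k (HopfQ.Rel q) (FreeAlgebra.ι k x)

/-- The element `D₁` of `H_q`. -/
abbrev D₁ : Hq q := of q .D₁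
/-- The element `D₂` of `H_q`. -/
abbrev D₂ : Hq q := of q .D₂
/-- The element `σ` of `H_q`. -/
abbrev sig : Hq q := of q .sig
/-- The element `σ⁻¹` of `H_q`. -/
abbrev sigInv : Hq q := of q .sigInv

theorem D₁_mul_D₂ : D₁ q * D₂ q = D₂ q * D₁ q := by
  have h := RingQuot.mkAlgHom_rel k (HopfQ.Rel.comm (q := q))
  rw [map_mul, map_mul] at h; exact h

theorem sig_mul_sigInv : sig q * sigInv q = 1 := by
  have h := RingQuot.mkAlgHom_rel k (HopfQ.Rel.sig_inv (q := q))
  rw [map_mul, map_one] at h; exact h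

theorem sigInv_mul_sig : sigInv q * sig q = 1 := by
  have h := RingQuot.mkAlgHom_rel k (HopfQ.Rel.inv_sig (q := q))
  rw [map_mul, map_one] at h; exact h

theorem D₁_mul_sig : D₁ q * sig q = (q : k) • (sig q * D₁ q) := by
  have h := RingQuot.mkAlgHom_rel k (HopfQ.Rel.skew₁ (q := q))
  rw [map_smul, map_mul, map_mul] at h; exact h.symm

theorem D₂_mul_sig : D₂ q * sig q = (q : k) • (sig q * D₂ q) := by
  have h := RingQuot.mkAlgHom_rel k (HopfQ.Rel.skew₂ (q := q))
  rw [map_smul, map_mul, map_mul] at h; exact h.symm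

theorem D₁_pow {l : ℕ} (hl : 2 ≤ l) (hq : IsPrimitiveRoot (q : k) l) : D₁ q ^ l = 0 := by
  have h := RingQuot.mkAlgHom_rel k (HopfQ.Rel.nil₁ (q := q) l hl hq)
  rw [map_pow, map_zero] at h; exact h

theorem D₂_pow {l : ℕ} (hl : 2 ≤ l) (hq : IsPrimitiveRoot (q : k) l) : D₂ q ^ l = 0 := by
  have h := RingQuot.mkAlgHom_rel k (HopfQ.Rel.nil₂ (q := q) l hl hq)
  rw [map_pow, map_zero] at h; exact h

variable {q}

/-- The universal property of `H_q`. -/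
def lift {B : Type*} [Ring B] [Algebra k B] (d₁ d₂ s t : B) (h₁₂ : d₁ * d₂ = d₂ * d₁)
    (hst : s * t = 1) (hts : t * s = 1) (h₁ : d₁ * s = (q : k) • (s * d₁))
    (h₂ : d₂ * s = (q : k) • (s * d₂))
    (hn₁ : ∀ l : ℕ, 2 ≤ l → IsPrimitiveRoot (q : k) l → d₁ ^ l = 0)
    (hn₂ : ∀ l : ℕ, 2 ≤ l → IsPrimitiveRoot (q : k) l → d₂ ^ l = 0) : Hq q →ₐ[k] B :=
  RingQuot.liftAlgHom k (s := HopfQ.Rel q) ⟨FreeAlgebra.lift k fun x : HopfQ.Gen => match x with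
      | .D₁ => d₁
      | .D₂ => d₂
      | .sig => s
      | .sigInv => t, by
    intro x y h
    cases h with
    | comm => simpa using h₁₂
    | sig_inv => simpa using hst
    | inv_sig => simpa using hts
    | skew₁ => simpa using h₁.symm
    | skew₂ => simpa using h₂.symm
    | nil₁ l hl hq => simpa using hn₁ l hl hq
    | nil₂ l hl hq => simpa using hn₂ l hl hq⟩

section
variable {B : Type*} [Ring B] [Algebra k B] (d₁ d₂ s t : B) (h₁₂ : d₁ * d₂ = d₂ * d₁)
    (hst : s * t = 1) (hts : t * s = 1) (h₁ : d₁ * s = (q : k) • (s * d₁))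
    (h₂ : d₂ * s = (q : k) • (s * d₂))
    (hn₁ : ∀ l : ℕ, 2 ≤ l → IsPrimitiveRoot (q : k) l → d₁ ^ l = 0)
    (hn₂ : ∀ l : ℕ, 2 ≤ l → IsPrimitiveRoot (q : k) l → d₂ ^ l = 0)

@[simp] theorem lift_D₁ : lift d₁ d₂ s t h₁₂ hst hts h₁ h₂ hn₁ hn₂ (D₁ q) = d₁ := by
  simp only [lift, of]
  erw [RingQuot.liftAlgHom_mkAlgHom_apply]; simp

@[simp] theorem lift_D₂ : lift d₁ d₂ s t h₁₂ hst hts h₁ h₂ hn₁ hn₂ (D₂ q) = d₂ := by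
  simp only [lift, of]
  erw [RingQuot.liftAlgHom_mkAlgHom_apply]; simp

@[simp] theorem lift_sig : lift d₁ d₂ s t h₁₂ hst hts h₁ h₂ hn₁ hn₂ (sig q) = s := by
  simp only [lift, of]
  erw [RingQuot.liftAlgHom_mkAlgHom_apply]; simp

@[simp] theorem lift_sigInv : lift d₁ d₂ s t h₁₂ hst hts h₁ h₂ hn₁ hn₂ (sigInv q) = t := by
  simp only [lift, of]
  erw [RingQuot.liftAlgHom_mkAlgHom_apply]; simp

end

theorem hom_ext {B : Type*} [Ring B] [Algebra k B] {φ ψ : Hq q →ₐ[k] B}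
    (h₁ : φ (D₁ q) = ψ (D₁ q)) (h₂ : φ (D₂ q) = ψ (D₂ q)) (hs : φ (sig q) = ψ (sig q))
    (ht : φ (sigInv q) = ψ (sigInv q)) : φ = ψ := by
  apply RingQuot.ringQuot_ext' (S := k) (s := HopfQ.Rel q)
  apply FreeAlgebra.hom_ext
  funext x
  cases x
  exacts [h₁, h₂, hs, ht]

/-- Gaussian binomial coefficients. -/
def qChoose (q : k) : ℕ → ℕ → k
  | _, 0 => 1
  | 0, _ + 1 => 0
  | n + 1, j + 1 => qChoose q n j + q ^ (j + 1) * qChoose q n (j + 1)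

theorem qChoose_zero (q : k) (n : ℕ) : qChoose q n 0 = 1 := by cases n <;> simp [qChoose]

theorem qChoose_lt (q : k) (n : ℕ) : ∀ j, n < j → qChoose q n j = 0 := by
  induction n with
  | zero => intro j hj; cases j with
    | zero => omega
    | succ j => simp [qChoose]
  | succ n ih => intro j hj; cases j with
    | zero => omega
    | succ j => simp [qChoose, ih j (by omega), ih (j + 1) (by omega)]

theorem qChoose_self (q : k) (n : ℕ) : qChoose q n n = 1 := by
  induction n with
  | zero => simp [qChoose]
  | succ n ih => simp [qChoose, ih, qChoose_lt q n (n + 1) (by omega)]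

theorem qChoose_mul (q : k) (n : ℕ) : ∀ j,
    (1 - q ^ (j + 1)) * qChoose q (n + 1) (j + 1) = (1 - q ^ (n + 1)) * qChoose q n j := by
  induction n with
  | zero => intro j; cases j <;> simp [qChoose]
  | succ n ih =>
    intro j
    cases j with
    | zero =>
      have h := ih 0
      have e : qChoose q (n + 1 + 1) (0 + 1) =
        qChoose q (n + 1) 0 + q ^ (0 + 1) * qChoose q (n + 1) (0 + 1) := rfl
      rw [e]
      simp only [qChoose_zero] at h ⊢
      linear_combination q * h
    | succ i =>
      have h := ih i
      have h' := ih (i + 1)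
      have e : qChoose q (n + 1) (i + 1) = qChoose q n i + q ^ (i + 1) * qChoose q n (i + 1) := rfl
      have e' : qChoose q (n + 1 + 1) (i + 1 + 1) =
        qChoose q (n + 1) (i + 1) + q ^ (i + 1 + 1) * qChoose q (n + 1) (i + 1 + 1) := rfl
      rw [e']
      linear_combination q ^ (i + 2) * h' + q * h - q * (1 - q ^ (n + 1)) * e

theorem qChoose_eq_zero {q : k} {l : ℕ} (hq : IsPrimitiveRoot q l) {j : ℕ} (hj : 0 < j)
    (hjl : j < l) : qChoose q l j = 0 := by
  obtain ⟨i, rfl⟩ : ∃ i, j = i + 1 := ⟨j - 1, by omega⟩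
  obtain ⟨n, rfl⟩ : ∃ n, l = n + 1 := ⟨l - 1, by omega⟩
  have h := qChoose_mul q n i
  rw [hq.pow_eq_one, sub_self, zero_mul, mul_eq_zero] at h
  refine h.resolve_left fun h0 => ?_
  exact hq.pow_ne_one_of_pos_of_lt (by omega) hjl (sub_eq_zero.mp h0).symm

theorem skew_pow {B : Type*} [Ring B] [Algebra k B] {X Y : B} {q : k}
    (h : Y * X = q • (X * Y)) (j : ℕ) : Y * X ^ j = q ^ j • (X ^ j * Y) := by
  induction j with
  | zero => simp
  | succ j ih =>
    rw [pow_succ, ← mul_assoc, ih, smul_mul_assoc, mul_assoc, h, mul_smul_comm, smul_smul,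
      ← mul_assoc, ← pow_succ]

theorem add_pow_skew {B : Type*} [Ring B] [Algebra k B] {X Y : B} {q : k}
    (h : Y * X = q • (X * Y)) (n : ℕ) :
    (X + Y) ^ n = ∑ j ∈ Finset.range (n + 1), qChoose q n j • (X ^ j * Y ^ (n - j)) := by
  induction n with
  | zero => simp [qChoose]
  | succ n ih =>
    rw [pow_succ', ih, add_mul, Finset.mul_sum, Finset.mul_sum, Finset.sum_range_succ' _ (n + 1)]
    have e1 : ∀ j ∈ Finset.range (n + 1),
        qChoose q (n + 1) (j + 1) • (X ^ (j + 1) * Y ^ (n + 1 - (j + 1))) =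
        X * (qChoose q n j • (X ^ j * Y ^ (n - j))) +
        (q ^ (j + 1) * qChoose q n (j + 1)) • (X ^ (j + 1) * Y ^ (n - j)) := by
      intro j _
      rw [qChoose, add_smul, mul_smul_comm, ← mul_assoc, ← pow_succ', Nat.add_sub_add_right]
    rw [Finset.sum_congr rfl e1, Finset.sum_add_distrib, add_assoc]
    congr 1
    rw [Finset.sum_range_succ (fun x => (q ^ (x + 1) * qChoose q n (x + 1)) • _) n,
      qChoose_lt q n (n + 1) (by omega), mul_zero, zero_smul,
      add_zero, Finset.sum_range_succ' _ n]
    congr 1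
    · refine Finset.sum_congr rfl fun j hj => ?_
      have hj' := Finset.mem_range.mp hj
      rw [mul_smul_comm, ← mul_assoc, skew_pow h, smul_mul_assoc, mul_assoc, ← pow_succ', smul_smul,
        mul_comm, show n - (j + 1) + 1 = n - j by omega]
    · simp [qChoose_zero, pow_succ']

theorem add_pow_primitive {B : Type*} [Ring B] [Algebra k B] {X Y : B} {q : k}
    (h : Y * X = q • (X * Y)) {l : ℕ} (hl : 2 ≤ l) (hq : IsPrimitiveRoot q l) :
    (X + Y) ^ l = X ^ l + Y ^ l := by
  obtain ⟨n, rfl⟩ : ∃ n, l = n + 1 := ⟨l - 1, by omega⟩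
  rw [add_pow_skew h, Finset.sum_range_succ, Finset.sum_range_succ' _ n, Finset.sum_eq_zero]
  · simp [qChoose_self, qChoose_zero, add_comm]
  · intro j hj
    have := Finset.mem_range.mp hj
    rw [qChoose_eq_zero hq (by omega) (by omega), zero_smul]

variable (q)

/-- `Δ(D₁) = D₁ ⊗ σ + 1 ⊗ D₁`, `Δ(D₂) = D₂ ⊗ 1 + σ ⊗ D₂`, `Δ(σ) = σ ⊗ σ`. -/
def comulHom : Hq q →ₐ[k] Hq q ⊗[k] Hq q :=
  lift (D₁ q ⊗ₜ sig q + 1 ⊗ₜ D₁ q) (D₂ q ⊗ₜ 1 + sig q ⊗ₜ D₂ q) (sig q ⊗ₜ sig q)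
    (sigInv q ⊗ₜ sigInv q)
    (by
      simp only [add_mul, mul_add, Algebra.TensorProduct.tmul_mul_tmul, one_mul, mul_one,
        D₁_mul_D₂, D₁_mul_sig, D₂_mul_sig, TensorProduct.smul_tmul', TensorProduct.tmul_smul]
      abel)
    (by simp only [Algebra.TensorProduct.tmul_mul_tmul, sig_mul_sigInv,
      Algebra.TensorProduct.one_def])
    (by simp only [Algebra.TensorProduct.tmul_mul_tmul, sigInv_mul_sig,
      Algebra.TensorProduct.one_def])
    (by simp only [add_mul, mul_add, Algebra.TensorProduct.tmul_mul_tmul, one_mul, mul_one,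
        D₁_mul_sig, TensorProduct.smul_tmul', TensorProduct.tmul_smul, smul_add])
    (by simp only [add_mul, mul_add, Algebra.TensorProduct.tmul_mul_tmul, one_mul, mul_one,
        D₂_mul_sig, TensorProduct.smul_tmul', TensorProduct.tmul_smul, smul_add])
    (by
      intro l hl hq
      rw [add_pow_primitive (q := (q : k)) _ hl hq]
      · simp [Algebra.TensorProduct.tmul_pow, D₁_pow q hl hq]
      · simp [Algebra.TensorProduct.tmul_mul_tmul, D₁_mul_sig])
    (by
      intro l hl hq
      rw [add_comm, add_pow_primitive (q := (q : k)) _ hl hq]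
      · simp [Algebra.TensorProduct.tmul_pow, D₂_pow q hl hq]
      · simp [Algebra.TensorProduct.tmul_mul_tmul, D₂_mul_sig, TensorProduct.smul_tmul'])

/-- `ε(D₁) = ε(D₂) = 0`, `ε(σ) = 1`. -/
def counitHom : Hq q →ₐ[k] k :=
  lift 0 0 1 1 (by simp) (by simp) (by simp) (by simp) (by simp)
    (fun l hl _ => zero_pow (by omega)) (fun l hl _ => zero_pow (by omega))

@[simp] theorem comulHom_D₁ : comulHom q (D₁ q) = D₁ q ⊗ₜ sig q + 1 ⊗ₜ D₁ q := lift_D₁ ..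
@[simp] theorem comulHom_D₂ : comulHom q (D₂ q) = D₂ q ⊗ₜ 1 + sig q ⊗ₜ D₂ q := lift_D₂ ..
@[simp] theorem comulHom_sig : comulHom q (sig q) = sig q ⊗ₜ sig q := lift_sig ..
@[simp] theorem comulHom_sigInv : comulHom q (sigInv q) = sigInv q ⊗ₜ sigInv q := lift_sigInv ..
@[simp] theorem counitHom_D₁ : counitHom q (D₁ q) = 0 := lift_D₁ ..
@[simp] theorem counitHom_D₂ : counitHom q (D₂ q) = 0 := lift_D₂ ..
@[simp] theorem counitHom_sig : counitHom q (sig q) = 1 := lift_sig ..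
@[simp] theorem counitHom_sigInv : counitHom q (sigInv q) = 1 := lift_sigInv ..

instance : Bialgebra k (Hq q) := Bialgebra.ofAlgHom (comulHom q) (counitHom q)
  (by
    apply hom_ext <;>
      simp [TensorProduct.add_tmul, TensorProduct.tmul_add, Algebra.TensorProduct.one_def,
        add_assoc])
  (by apply hom_ext <;> simp)
  (by apply hom_ext <;> simp)

end Hq

/-! ### Braided module algebras over a bialgebra (with the flip as braid) -/

section Braided

variable {k H A : Type*} [Field k] [Ring H] [Bialgebra k H] [Ring A] [Algebra k A]

/-- `(s ⊗ H) ∘ (H ⊗ s)`. -/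
def slideH (s : H ⊗[k] A →ₗ[k] A ⊗[k] H) : H ⊗[k] (H ⊗[k] A) →ₗ[k] A ⊗[k] (H ⊗[k] H) :=
  (TensorProduct.assoc k A H H).toLinearMap ∘ₗ s.rTensor H ∘ₗ
    (TensorProduct.assoc k H A H).symm.toLinearMap ∘ₗ s.lTensor H

/-- `(A ⊗ s) ∘ (s ⊗ A)`. -/
def slideA (s : H ⊗[k] A →ₗ[k] A ⊗[k] H) : H ⊗[k] (A ⊗[k] A) →ₗ[k] (A ⊗[k] A) ⊗[k] H :=
  (TensorProduct.assoc k A A H).symm.toLinearMap ∘ₗ s.lTensor A ∘ₗ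
    (TensorProduct.assoc k A H A).toLinearMap ∘ₗ s.rTensor A ∘ₗ
    (TensorProduct.assoc k H A A).symm.toLinearMap

/-- `c ⊗ A`, where `c` is the flip of `H ⊗ H`. -/
def flipTensor (k H A : Type*) [Field k] [Ring H] [Bialgebra k H] [Ring A] [Algebra k A] :
    H ⊗[k] (H ⊗[k] A) →ₗ[k] H ⊗[k] (H ⊗[k] A) :=
  (TensorProduct.assoc k H H A).toLinearMap ∘ₗ
    (TensorProduct.comm k H H).toLinearMap.rTensor A ∘ₗ
    (TensorProduct.assoc k H H A).symm.toLinearMap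

/-- Left transpositions of the bialgebra `H` (with the flip as braid) on the algebra `A`. -/
structure IsLeftTransposition (s : H ⊗[k] A →ₗ[k] A ⊗[k] H) : Prop where
  bijective : Function.Bijective s
  /-- compatibility with the unit of `H` -/
  one_left : ∀ a : A, s (1 ⊗ₜ a) = a ⊗ₜ 1
  /-- compatibility with the multiplication of `H` -/
  mul_left : s ∘ₗ (LinearMap.mul' k H).rTensor A ∘ₗ (TensorProduct.assoc k H H A).symm.toLinearMap
    = (LinearMap.mul' k H).lTensor A ∘ₗ slideH s
  /-- compatibility with the counit of `H` -/
  counit : (TensorProduct.rid k A).toLinearMap ∘ₗ (Coalgebra.counit (R := k) (A := H)).lTensor A ∘ₗ s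
    = (TensorProduct.lid k A).toLinearMap ∘ₗ (Coalgebra.counit (R := k) (A := H)).rTensor A
  /-- compatibility with the comultiplication of `H` -/
  comul : (Coalgebra.comul (R := k) (A := H)).lTensor A ∘ₗ s
    = slideH s ∘ₗ (TensorProduct.assoc k H H A).toLinearMap ∘ₗ
      (Coalgebra.comul (R := k) (A := H)).rTensor A
  /-- compatibility with the braid of `H` -/
  braid : slideH s ∘ₗ flipTensor k H A
    = (TensorProduct.comm k H H).toLinearMap.lTensor A ∘ₗ slideH s
  /-- compatibility with the unit of `A` -/
  one_right : ∀ h : H, s (h ⊗ₜ 1) = 1 ⊗ₜ h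
  /-- compatibility with the multiplication of `A` -/
  mul_right : s ∘ₗ (LinearMap.mul' k A).lTensor H = (LinearMap.mul' k A).rTensor H ∘ₗ slideA s

/-- The map `ρ : H ⊗ A → A` of a left `H`-module structure on `A`. -/
def actionMap (ρ : H →ₐ[k] Module.End k A) : H ⊗[k] A →ₗ[k] A := TensorProduct.lift ρ.toLinearMap

/-- `(A, s)` is a left `H`-module algebra via the left `H`-module structure `ρ` on `A`. -/
structure IsBraidedModuleAlgebra (s : H ⊗[k] A →ₗ[k] A ⊗[k] H)
    (ρ : H →ₐ[k] Module.End k A) : Prop where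
  transposition : IsLeftTransposition s
  /-- `s ∘ (H ⊗ ρ) = (ρ ⊗ H) ∘ (H ⊗ s) ∘ (c ⊗ A)` -/
  compat : s ∘ₗ (actionMap ρ).lTensor H
    = (actionMap ρ).rTensor H ∘ₗ (TensorProduct.assoc k H A H).symm.toLinearMap ∘ₗ
      s.lTensor H ∘ₗ flipTensor k H A
  /-- `μ ∘ (ρ ⊗ ρ) ∘ (H ⊗ s ⊗ A) ∘ (Δ ⊗ A ⊗ A) = ρ ∘ (H ⊗ μ)` -/
  mul : LinearMap.mul' k A ∘ₗ TensorProduct.map (actionMap ρ) (actionMap ρ) ∘ₗ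
      (TensorProduct.assoc k H A (H ⊗[k] A)).symm.toLinearMap ∘ₗ
      ((TensorProduct.assoc k A H A).toLinearMap ∘ₗ s.rTensor A ∘ₗ
        (TensorProduct.assoc k H A A).symm.toLinearMap).lTensor H ∘ₗ
      (TensorProduct.assoc k H H (A ⊗[k] A)).toLinearMap ∘ₗ
      (Coalgebra.comul (R := k) (A := H)).rTensor (A ⊗[k] A)
    = actionMap ρ ∘ₗ (LinearMap.mul' k A).lTensor H
  one : ∀ h : H, ρ h 1 = Coalgebra.counit (R := k) h • (1 : A)

end Braided

/-! ### The good transposition of `H_q` associated with an algebra automorphism -/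

section Good

variable {k A : Type*} [Field k] [Ring A] [Algebra k A] (q : kˣ) (α : A ≃ₐ[k] A)

/-- The algebra map `H_q → End(A) ⊗ H_q` with `D₁ ↦ α ⊗ D₁`, `D₂ ↦ α⁻¹ ⊗ D₂`, `σ ↦ 1 ⊗ σ`. -/
def goodHom : Hq q →ₐ[k] Module.End k A ⊗[k] Hq q :=
  Hq.lift (q := q) (B := Module.End k A ⊗[k] Hq q) ((α.toLinearMap : Module.End k A) ⊗ₜ Hq.D₁ q)
    ((α.symm.toLinearMap : Module.End k A) ⊗ₜ Hq.D₂ q) (1 ⊗ₜ Hq.sig q) (1 ⊗ₜ Hq.sigInv q)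
    (by
      have h1 : (α.toLinearMap : Module.End k A) * α.symm.toLinearMap = 1 := by
        ext a; simp
      have h2 : (α.symm.toLinearMap : Module.End k A) * α.toLinearMap = 1 := by
        ext a; simp
      rw [Algebra.TensorProduct.tmul_mul_tmul, Algebra.TensorProduct.tmul_mul_tmul, h1, h2,
        Hq.D₁_mul_D₂])
    (by rw [Algebra.TensorProduct.tmul_mul_tmul, Hq.sig_mul_sigInv, one_mul]; rfl)
    (by rw [Algebra.TensorProduct.tmul_mul_tmul, Hq.sigInv_mul_sig, one_mul]; rfl)
    (by rw [Algebra.TensorProduct.tmul_mul_tmul, Algebra.TensorProduct.tmul_mul_tmul,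
      Hq.D₁_mul_sig, one_mul, mul_one, TensorProduct.tmul_smul])
    (by rw [Algebra.TensorProduct.tmul_mul_tmul, Algebra.TensorProduct.tmul_mul_tmul,
      Hq.D₂_mul_sig, one_mul, mul_one, TensorProduct.tmul_smul])
    (fun l hl hq => by rw [Algebra.TensorProduct.tmul_pow, Hq.D₁_pow q hl hq,
      TensorProduct.tmul_zero])
    (fun l hl hq => by rw [Algebra.TensorProduct.tmul_pow, Hq.D₂_pow q hl hq,
      TensorProduct.tmul_zero])

/-- The good transposition `s : H_q ⊗ A → A ⊗ H_q` associated with `α`, that is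
`s(σ^i D₁^j D₂^m ⊗ a) = α^(j-m)(a) ⊗ σ^i D₁^j D₂^m`. -/
def goodTransposition : Hq q ⊗[k] A →ₗ[k] A ⊗[k] Hq q :=
  TensorProduct.lift (TensorProduct.rTensorHomToHomRTensor (.id k) A A (Hq q) ∘ₗ
     (goodHom q α).toLinearMap)

theorem goodTransposition_D₁ (a : A) :
    goodTransposition q α (Hq.D₁ q ⊗ₜ a) = α a ⊗ₜ Hq.D₁ q := by
  simp [goodTransposition, goodHom]

theorem goodTransposition_D₂ (a : A) :
    goodTransposition q α (Hq.D₂ q ⊗ₜ a) = α.symm a ⊗ₜ Hq.D₂ q := by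
  simp [goodTransposition, goodHom]

theorem goodTransposition_sig (a : A) :
    goodTransposition q α (Hq.sig q ⊗ₜ a) = a ⊗ₜ Hq.sig q := by
  simp [goodTransposition, goodHom]

end Good

/-! ### The crossed product `S(V) #_f G` -/

/-- Normal 2-cocycles `f : G × G → kˣ`. -/
structure NormalCocycle (G k : Type*) [Group G] [Field k] where
  toFun : G → G → kˣ
  one_left : ∀ g, toFun 1 g = 1
  one_right : ∀ g, toFun g 1 = 1
  cocycle : ∀ g h l, toFun g h * toFun (g * h) l = toFun h l * toFun g (h * l)

instance {G k : Type*} [Group G] [Field k] :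
    CoeFun (NormalCocycle G k) (fun _ => G → G → kˣ) := ⟨NormalCocycle.toFun⟩

/-- The algebra endomorphism of `S(V)` extending the linear map `φ : V → V`. -/
def symMap {k V : Type*} [Field k] [AddCommGroup V] [Module k V] (φ : V →ₗ[k] V) :
    SymmetricAlgebra k V →ₐ[k] SymmetricAlgebra k V :=
  SymmetricAlgebra.lift (SymmetricAlgebra.ι k V ∘ₗ φ)

section SymMap
variable {k V : Type*} [Field k] [AddCommGroup V] [Module k V]

@[simp] theorem symMap_ι (φ : V →ₗ[k] V) (v : V) :
    symMap φ (SymmetricAlgebra.ι k V v) = SymmetricAlgebra.ι k V (φ v) := by simp [symMap]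

theorem symMap_symMap (φ ψ : V →ₗ[k] V) (P : SymmetricAlgebra k V) :
    symMap φ (symMap ψ P) = symMap (φ ∘ₗ ψ) P := by
  have : (symMap φ).comp (symMap ψ) = symMap (φ ∘ₗ ψ) := by
    apply SymmetricAlgebra.algHom_ext; ext v; simp
  exact DFunLike.congr_fun this P

theorem symMap_id (P : SymmetricAlgebra k V) : symMap LinearMap.id P = P := by
  have : symMap LinearMap.id = AlgHom.id k (SymmetricAlgebra k V) := by
    apply SymmetricAlgebra.algHom_ext; ext v; simp
  exact DFunLike.congr_fun this P

end SymMap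

/-- The crossed product `A = S(V) #_f G`: the free left `S(V)`-module with basis
`(w_g)_{g ∈ G}`, with product `(P w_g)(Q w_h) = f(g,h) P ᵍQ w_{gh}`. -/
def CrossedProduct {k G V : Type*} [Field k] [Group G] [AddCommGroup V] [Module k V]
    (_r : Representation k G V) (_f : NormalCocycle G k) : Type _ := G →₀ SymmetricAlgebra k V

namespace CrossedProduct

variable {k G V : Type*} [Field k] [Group G] [AddCommGroup V] [Module k V]
  (r : Representation k G V) (f : NormalCocycle G k)

instance : AddCommGroup (CrossedProduct r f) :=
  inferInstanceAs (AddCommGroup (G →₀ SymmetricAlgebra k V))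
instance : Module k (CrossedProduct r f) :=
  inferInstanceAs (Module k (G →₀ SymmetricAlgebra k V))

/-- `single r f g P` is the element `P w_g`. -/
def single (g : G) : SymmetricAlgebra k V →ₗ[k] CrossedProduct r f := Finsupp.lsingle g

/-- The linear map determined by its values on the elements `P w_g`. -/
def lsum {M : Type*} [AddCommGroup M] [Module k M] (F : G → SymmetricAlgebra k V →ₗ[k] M) :
    CrossedProduct r f →ₗ[k] M := Finsupp.lsum k F

variable {r f}

@[simp] theorem lsum_single {M : Type*} [AddCommGroup M] [Module k M]
    (F : G → SymmetricAlgebra k V →ₗ[k] M) (g : G) (P : SymmetricAlgebra k V) :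
    lsum r f F (single r f g P) = F g P := by
  simp only [lsum, single]
  erw [Finsupp.lsum_single]

@[elab_as_elim]
theorem induction_on {motive : CrossedProduct r f → Prop} (a : CrossedProduct r f)
    (zero : motive 0) (add : ∀ a b, motive a → motive b → motive (a + b))
    (single : ∀ g P, motive (single r f g P)) : motive a :=
  Finsupp.induction_linear (motive := motive) a zero add single

variable (r f)

/-- The multiplication of the crossed product. -/
def mulBilin : CrossedProduct r f →ₗ[k] CrossedProduct r f →ₗ[k] CrossedProduct r f :=
  lsum r f fun g => LinearMap.flip (lsum r f fun h => LinearMap.flip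
    (((LinearMap.mul k (SymmetricAlgebra k V)).compl₂ (symMap (r g)).toLinearMap).compr₂
      ((f g h : k) • single r f (g * h))))

instance : Mul (CrossedProduct r f) := ⟨fun a b => mulBilin r f a b⟩
instance : One (CrossedProduct r f) := ⟨single r f 1 1⟩

variable {r f}

theorem mul_def (a b : CrossedProduct r f) : a * b = mulBilin r f a b := rfl
theorem one_def : (1 : CrossedProduct r f) = single r f 1 1 := rfl

theorem single_mul_single (g h : G) (P Q : SymmetricAlgebra k V) :
    single r f g P * single r f h Q = (f g h : k) • single r f (g * h) (P * symMap (r g) Q) := by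
  simp [mul_def, mulBilin]

instance : Ring (CrossedProduct r f) :=
  { (inferInstance : AddCommGroup (CrossedProduct r f)),
    (inferInstance : Mul (CrossedProduct r f)), (inferInstance : One (CrossedProduct r f)) with
    left_distrib := fun a b c => by simp [mul_def]
    right_distrib := fun a b c => by simp [mul_def]
    zero_mul := fun a => by simp [mul_def]
    mul_zero := fun a => by simp [mul_def]
    one_mul := fun a => by
      induction a using induction_on with
      | zero => simp [mul_def]
      | add a b ha hb => rw [mul_def, map_add, ← mul_def, ← mul_def, ha, hb]
      | single g P =>
        rw [one_def, single_mul_single, f.one_left, map_one, Module.End.one_eq_id, symMap_id]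
        simp
    mul_one := fun a => by
      induction a using induction_on with
      | zero => simp [mul_def]
      | add a b ha hb =>
        rw [mul_def, map_add, LinearMap.add_apply, ← mul_def, ← mul_def, ha, hb]
      | single g P =>
        rw [one_def, single_mul_single, f.one_right, map_one]
        simp
    mul_assoc := fun a b c => by
      simp only [mul_def]
      induction a using induction_on with
      | zero => simp
      | add a b ha hb => simp only [map_add, LinearMap.add_apply, ha, hb]
      | single g P =>
      induction b using induction_on with
      | zero => simp
      | add a b ha hb => simp only [map_add, LinearMap.add_apply, ha, hb]
      | single h Q =>
      induction c using induction_on with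
      | zero => simp
      | add a b ha hb => simp only [map_add, ha, hb]
      | single l R =>
        simp only [← mul_def, single_mul_single]
        rw [mul_def, mul_def, map_smul, LinearMap.smul_apply, map_smul, ← mul_def, ← mul_def,
          single_mul_single, single_mul_single, smul_smul, smul_smul, ← Units.val_mul,
          ← Units.val_mul, f.cocycle, map_mul (symMap (r g)), symMap_symMap, mul_assoc g h l,
          mul_assoc P, map_mul r g h, Module.End.mul_eq_comp] }

instance : Algebra k (CrossedProduct r f) :=
  Algebra.ofModule (fun c a b => by simp [mul_def]) (fun c a b => by simp [mul_def])

variable (r f)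

/-- The inclusion `V ⊆ A`. -/
def ofV : V →ₗ[k] CrossedProduct r f := single r f 1 ∘ₗ SymmetricAlgebra.ι k V

/-- The element `w_g` of `A`. -/
def w (g : G) : CrossedProduct r f := single r f g 1

/-- The linear map `A → A` with `v₁ ⋯ vₘ w_g ↦ φ(v₁) ⋯ φ(vₘ) χ(g) w_g`. -/
def diagMap (φ : V →ₗ[k] V) (χ : G → kˣ) : CrossedProduct r f →ₗ[k] CrossedProduct r f :=
  lsum r f fun g => (χ g : k) • (single r f g ∘ₗ (symMap φ).toLinearMap)

variable {r f}

@[simp] theorem diagMap_single (φ : V →ₗ[k] V) (χ : G → kˣ) (g : G) (P : SymmetricAlgebra k V) :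
    diagMap r f φ χ (single r f g P) = (χ g : k) • single r f g (symMap φ P) := by
  simp [diagMap]

variable (f)

/-- The automorphism `α` of `A` determined by a bijective `k[G]`-linear map `φ : V → V` and a
group homomorphism `χ : G → kˣ`. -/
def diagAut (φ : V ≃ₗ[k] V) (hφ : ∀ g v, φ (r g v) = r g (φ v)) (χ : G →* kˣ) :
    CrossedProduct r f ≃ₐ[k] CrossedProduct r f :=
  AlgEquiv.ofLinearEquiv
    (LinearEquiv.ofLinearMap (diagMap r f φ.toLinearMap χ) (diagMap r f φ.symm.toLinearMap χ⁻¹)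
      (by
        ext a
        induction a using induction_on with
        | zero => simp
        | add a b ha hb => simp only [map_add, ha, hb]
        | single g P =>
          simp [symMap_symMap, smul_smul, symMap_id])
      (by
        ext a
        induction a using induction_on with
        | zero => simp
        | add a b ha hb => simp only [map_add, ha, hb]
        | single g P =>
          simp [symMap_symMap, smul_smul, symMap_id]))
    (by simp [one_def])
    (by
      intro a b
      simp only [LinearEquiv.coe_ofLinearMap]
      induction a using induction_on with
      | zero => simp
      | add a b ha hb => simp only [map_add, add_mul, ha, hb]
      | single g P =>
      induction b using induction_on with
      | zero => simp
      | add a b ha hb => simp only [map_add, mul_add, ha, hb]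
      | single h Q =>
        have e : φ.toLinearMap ∘ₗ r g = r g ∘ₗ φ.toLinearMap := by ext v; simp [hφ]
        simp only [diagMap_single, single_mul_single, map_smul, smul_mul_assoc, mul_smul_comm,
          map_mul, symMap_symMap, e, smul_smul, Units.val_mul]
        congr 1
        ring)

theorem diagAut_apply (φ : V ≃ₗ[k] V) (hφ : ∀ g v, φ (r g v) = r g (φ v)) (χ : G →* kˣ)
    (a : CrossedProduct r f) : diagAut f φ hφ χ a = diagMap r f φ.toLinearMap χ a := rfl

variable {f}

/-- `δ` satisfies, for all `v₁, …, vₘ ∈ V` and `g ∈ G`,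
`δ(v₁ ⋯ vₘ w_g) = ∑ⱼ a(v₁ ⋯ vⱼ₋₁) δ'(vⱼ) b(vⱼ₊₁ ⋯ vₘ w_g)`. -/
def IsSkewExtension (a b : CrossedProduct r f →ₗ[k] CrossedProduct r f)
    (δ' : V →ₗ[k] CrossedProduct r f) (δ : Module.End k (CrossedProduct r f)) : Prop :=
  ∀ (m : ℕ) (v : Fin m → V) (g : G),
    δ (single r f g (∏ i, SymmetricAlgebra.ι k V (v i))) =
      ∑ j, a (single r f 1 (∏ i ∈ Finset.Iio j, SymmetricAlgebra.ι k V (v i))) * δ' (v j) *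
        b (single r f g (∏ i ∈ Finset.Ioi j, SymmetricAlgebra.ι k V (v i)))

end CrossedProduct

end

/-! Read on the generators of `H_q`, a module algebra structure on `(A, s)` is an algebra
automorphism `ς` of `A` together with two skew derivations, δ₁(ab) = δ₁(a)ς(b) + α(a)δ₁(b) and
δ₂(ab) = δ₂(a)b + ς(α⁻¹(a))δ₂(b), such that all three maps commute with `α` and satisfy the
relations of `H_q`. That these data suffice is `isBraidedModuleAlgebra_of_generators`; that they are
forced comes from evaluating the axioms at `D₁`, `D₂` and `σ`.

The question is therefore when the prescribed values on `V` and on the `w_g` extend to such maps.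
The algebra `A` is generated by these elements with relations uv = vu, w_g v = ᵍv w_g and w_g w_h =
f(g,h) w_{gh}. For `ς` this gives (1). For δᵢ, the relation uv = vu gives (2) (given (7) when i =
2), because the kernel of δ̂ᵢ is a hyperplane and S(V) is a domain; the relation w_g v = ᵍv w_g
gives (3)–(6); the last relation is harmless since δᵢ kills every w_g. Existence of δᵢ comes from a
homomorphism into upper triangular 2 × 2 matrices (`exists_isSkewExtension`), and the full Leibniz
rule from `IsSkewExtension.isSkewDerivation`.

The remaining relations are identities between maps obeying a common twisted Leibniz rule, so they
can be tested on `V`. Modulo the kernels only xᵢ matters there, and δᵢ(xᵢ) = Pᵢ w_{gᵢ}: commutation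
with `α` and `ς` becomes (7) and (9) (`IsSkewDerivation.commute_diagMap`). In δ₁δ₂ - δ₂δ₁ the cross
terms cancel (`skewDerivations_commute`), and on `V` it vanishes by (8). Nilpotency is (10). The two
directions are `isAdmissible_of_action` and `exists_action_of_isAdmissible`. -/

noncomputable section

/-! ### Words in the generators of `H_q` and their weights -/

namespace Hq

variable {k : Type*} [Field k] {q : kˣ}

@[elab_as_elim]
theorem induction {motive : Hq q → Prop} (algebraMap : ∀ c, motive (algebraMap k (Hq q) c))
    (of : ∀ x, motive (of q x)) (mul : ∀ a b, motive a → motive b → motive (a * b))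
    (add : ∀ a b, motive a → motive b → motive (a + b)) (h : Hq q) : motive h := by
  obtain ⟨h, rfl⟩ := RingQuot.mkAlgHom_surjective k (HopfQ.Rel q) h
  induction h using FreeAlgebra.induction with
  | grade0 c => rw [AlgHom.commutes]; exact algebraMap c
  | grade1 x => exact of x
  | mul a b ha hb => rw [map_mul]; exact mul _ _ ha hb
  | add a b ha hb => rw [map_add]; exact add _ _ ha hb

/-- Detected by the two-dimensional representation in which `D₁` is a matrix unit, `D₂` is zero and
`σ` is diag(1, q). It allows a tensor factor `D₁` to be cancelled in the compatibility axiom. -/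
theorem D₁_ne_zero : D₁ q ≠ 0 := by
  intro h
  have hn : ∀ l : ℕ, 2 ≤ l → IsPrimitiveRoot (q : k) l →
      (!![0, 1; 0, 0] : Matrix (Fin 2) (Fin 2) k) ^ l = 0 := by
    intro l hl _
    obtain ⟨n, rfl⟩ := Nat.exists_eq_add_of_le hl
    have h2 : (!![0, 1; 0, 0] : Matrix (Fin 2) (Fin 2) k) ^ 2 = 0 := by
      rw [pow_two, Matrix.mul_fin_two]; ext i j; fin_cases i <;> fin_cases j <;> simp
    rw [pow_add, h2, zero_mul]
  have := congrArg (lift (q := q) (B := Matrix (Fin 2) (Fin 2) k) !![0, 1; 0, 0] 0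
    !![1, 0; 0, (q : k)] !![1, 0; 0, ((q⁻¹ : kˣ) : k)] (by simp)
    (by simp [Matrix.one_fin_two]) (by simp [Matrix.one_fin_two])
    (by ext i j; fin_cases i <;> fin_cases j <;> simp) (by simp)
    hn (fun l hl _ => zero_pow (by omega))) h
  rw [lift_D₁, map_zero] at this
  simpa using congrFun (congrFun this 0) 1

/-- `Monomial n h` says that `h` is a word in the generators with `n` letters `D₁` minus the number
of letters `D₂`. -/
inductive Monomial (q : kˣ) : ℤ → Hq q → Prop
  | one : Monomial q 0 1
  | D₁_mul {n h} : Monomial q n h → Monomial q (n + 1) (D₁ q * h)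
  | D₂_mul {n h} : Monomial q n h → Monomial q (n - 1) (D₂ q * h)
  | sig_mul {n h} : Monomial q n h → Monomial q n (sig q * h)
  | sigInv_mul {n h} : Monomial q n h → Monomial q n (sigInv q * h)

/-- The span of the words is stable under left multiplication by every generator and contains 1.
Only spanning is used later, so no basis of `H_q` and no uniqueness of weights is needed. -/
theorem span_monomial (h : Hq q) : h ∈ Submodule.span k {h | ∃ n, Monomial q n h} := by
  suffices H : ∀ x : Hq q, x ∈ Submodule.span k {h | ∃ n, Monomial q n h} →
      h * x ∈ Submodule.span k {h | ∃ n, Monomial q n h} by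
    simpa using H 1 (Submodule.subset_span ⟨0, .one⟩)
  induction h using induction with
  | algebraMap c => intro x hx; rw [← Algebra.smul_def]; exact Submodule.smul_mem _ _ hx
  | mul a b ha hb => intro x hx; rw [mul_assoc]; exact ha _ (hb _ hx)
  | add a b ha hb => intro x hx; rw [add_mul]; exact add_mem (ha _ hx) (hb _ hx)
  | of y =>
    intro x hx
    induction hx using Submodule.span_induction with
    | zero => simp
    | add a b _ _ ha hb => rw [mul_add]; exact add_mem ha hb
    | smul c a _ ha => rw [mul_smul_comm]; exact Submodule.smul_mem _ _ ha
    | mem x hx =>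
      obtain ⟨n, hn⟩ := hx
      apply Submodule.subset_span
      cases y
      exacts [⟨_, hn.D₁_mul⟩, ⟨_, hn.D₂_mul⟩, ⟨_, hn.sig_mul⟩, ⟨_, hn.sigInv_mul⟩]

theorem linearMap_ext_monomial {M : Type*} [AddCommMonoid M] [Module k M] {φ ψ : Hq q →ₗ[k] M}
    (H : ∀ n h, Monomial q n h → φ h = ψ h) : φ = ψ := by
  ext h
  have hh := span_monomial h
  induction hh using Submodule.span_induction with
  | zero => simp
  | add a b _ _ ha hb => simp [ha, hb]
  | smul c a _ ha => simp [ha]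
  | mem x hx => exact H _ _ hx.choose_spec

theorem comul_eq (h : Hq q) : Coalgebra.comul (R := k) h = comulHom q h := rfl
theorem counit_eq (h : Hq q) : Coalgebra.counit (R := k) h = counitHom q h := rfl

theorem Monomial.counit {n : ℤ} {h : Hq q} (hm : Monomial q n h) :
    n = 0 ∨ Coalgebra.counit (R := k) h = 0 := by
  induction hm with
  | one => exact .inl rfl
  | D₁_mul _ _ => right; rw [counit_eq, map_mul, counitHom_D₁, zero_mul]
  | D₂_mul _ _ => right; rw [counit_eq, map_mul, counitHom_D₂, zero_mul]
  | sig_mul _ ih => simpa [counit_eq] using ih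
  | sigInv_mul _ ih => simpa [counit_eq] using ih

/-- The comultiplication preserves total weight because each term of Δ of a generator has the weight
of that generator. -/
theorem Monomial.comul {n : ℤ} {h : Hq q} (hm : Monomial q n h) :
    Coalgebra.comul (R := k) h ∈ Submodule.span k
      {z : Hq q ⊗[k] Hq q | ∃ i j x y, i + j = n ∧ Monomial q i x ∧ Monomial q j y ∧
        x ⊗ₜ[k] y = z} := by
  have key : ∀ (m m' : ℤ) (d z : Hq q ⊗[k] Hq q)
      (_ : ∀ i j x y, i + j = m → Monomial q i x → Monomial q j y →
        d * (x ⊗ₜ[k] y) ∈ Submodule.span k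
      {z : Hq q ⊗[k] Hq q | ∃ i j x y, i + j = m' ∧ Monomial q i x ∧ Monomial q j y ∧
        x ⊗ₜ[k] y = z})
      (_ : z ∈ Submodule.span k
      {z : Hq q ⊗[k] Hq q | ∃ i j x y, i + j = m ∧ Monomial q i x ∧ Monomial q j y ∧
        x ⊗ₜ[k] y = z}), d * z ∈ Submodule.span k
      {z : Hq q ⊗[k] Hq q | ∃ i j x y, i + j = m' ∧ Monomial q i x ∧ Monomial q j y ∧
        x ⊗ₜ[k] y = z} := by
    intro m m' d z H hz
    induction hz using Submodule.span_induction with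
    | zero => simp
    | add a b _ _ ha hb => rw [mul_add]; exact add_mem ha hb
    | smul c a _ ha => rw [mul_smul_comm]; exact Submodule.smul_mem _ _ ha
    | mem z hz =>
      obtain ⟨i, j, x, y, hij, hx, hy, rfl⟩ := hz
      exact H i j x y hij hx hy
  induction hm with
  | one => exact Submodule.subset_span ⟨0, 0, 1, 1, by simp, .one, .one, by
      rw [comul_eq, map_one, Algebra.TensorProduct.one_def]⟩
  | D₁_mul _ ih =>
    rw [comul_eq, map_mul, comulHom_D₁]
    refine key _ _ _ _ (fun i j x y hij hx hy => ?_) ih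
    rw [add_mul, Algebra.TensorProduct.tmul_mul_tmul, Algebra.TensorProduct.tmul_mul_tmul, one_mul]
    exact add_mem
      (Submodule.subset_span ⟨_, _, _, _, by omega, hx.D₁_mul, hy.sig_mul, rfl⟩)
      (Submodule.subset_span ⟨_, _, _, _, by omega, hx, hy.D₁_mul, rfl⟩)
  | D₂_mul _ ih =>
    rw [comul_eq, map_mul, comulHom_D₂]
    refine key _ _ _ _ (fun i j x y hij hx hy => ?_) ih
    rw [add_mul, Algebra.TensorProduct.tmul_mul_tmul, Algebra.TensorProduct.tmul_mul_tmul, one_mul]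
    exact add_mem
      (Submodule.subset_span ⟨_, _, _, _, by omega, hx.D₂_mul, hy, rfl⟩)
      (Submodule.subset_span ⟨_, _, _, _, by omega, hx.sig_mul, hy.D₂_mul, rfl⟩)
  | sig_mul _ ih =>
    rw [comul_eq, map_mul, comulHom_sig]
    refine key _ _ _ _ (fun i j x y hij hx hy => ?_) ih
    rw [Algebra.TensorProduct.tmul_mul_tmul]
    exact Submodule.subset_span ⟨_, _, _, _, hij, hx.sig_mul, hy.sig_mul, rfl⟩
  | sigInv_mul _ ih =>
    rw [comul_eq, map_mul, comulHom_sigInv]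
    refine key _ _ _ _ (fun i j x y hij hx hy => ?_) ih
    rw [Algebra.TensorProduct.tmul_mul_tmul]
    exact Submodule.subset_span ⟨_, _, _, _, hij, hx.sigInv_mul, hy.sigInv_mul, rfl⟩

theorem Monomial.mul {m n : ℤ} {g h : Hq q} (hg : Monomial q m g) (hh : Monomial q n h) :
    Monomial q (m + n) (g * h) := by
  induction hg with
  | one => simpa using hh
  | D₁_mul _ ih => rw [mul_assoc, add_right_comm]; exact ih.D₁_mul
  | D₂_mul _ ih => rw [mul_assoc, sub_add_eq_add_sub]; exact ih.D₂_mul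
  | sig_mul _ ih => rw [mul_assoc]; exact ih.sig_mul
  | sigInv_mul _ ih => rw [mul_assoc]; exact ih.sigInv_mul

end Hq

/-! ### The transposition attached to an automorphism -/

section Good

variable {k A : Type*} [Field k] [Ring A] [Algebra k A] {q : kˣ} (α : A ≃ₐ[k] A)

theorem goodHom_D₁ : goodHom q α (Hq.D₁ q) = (α.toLinearMap : Module.End k A) ⊗ₜ Hq.D₁ q :=
  Hq.lift_D₁ ..
theorem goodHom_D₂ : goodHom q α (Hq.D₂ q) = (α.symm.toLinearMap : Module.End k A) ⊗ₜ Hq.D₂ q :=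
  Hq.lift_D₂ ..
theorem goodHom_sig : goodHom q α (Hq.sig q) = 1 ⊗ₜ Hq.sig q := Hq.lift_sig ..
theorem goodHom_sigInv : goodHom q α (Hq.sigInv q) = 1 ⊗ₜ Hq.sigInv q := Hq.lift_sigInv ..

theorem goodTransposition_tmul (h : Hq q) (a : A) :
    goodTransposition q α (h ⊗ₜ a) =
      rTensorHomToHomRTensor (.id k) A A (Hq q) (goodHom q α h) a := rfl

/-- Since `α` and its inverse are powers of one automorphism, a word twists by `α` to the power of
its weight, whatever the order of its letters. Every transposition axiom then reduces to bookkeeping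
of exponents. -/
theorem goodHom_monomial {n : ℤ} {h : Hq q} (hm : Hq.Monomial q n h) :
    goodHom q α h = ((α ^ n : A ≃ₐ[k] A).toLinearMap : Module.End k A) ⊗ₜ h := by
  have hmul : ∀ β γ : A ≃ₐ[k] A, (β.toLinearMap : Module.End k A) * γ.toLinearMap =
    (β * γ).toLinearMap := fun _ _ => rfl
  induction hm with
  | one => rw [map_one, zpow_zero]; rfl
  | D₁_mul _ ih =>
    rw [map_mul, ih, goodHom_D₁, Algebra.TensorProduct.tmul_mul_tmul, hmul, ← zpow_one_add,
      add_comm]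
  | D₂_mul _ ih =>
    rw [map_mul, ih, goodHom_D₂, Algebra.TensorProduct.tmul_mul_tmul, hmul,
      show α.symm = α⁻¹ from rfl, ← zpow_neg_one, ← zpow_add, neg_add_eq_sub]
  | sig_mul _ ih => rw [map_mul, ih, goodHom_sig, Algebra.TensorProduct.tmul_mul_tmul, one_mul]
  | sigInv_mul _ ih =>
    rw [map_mul, ih, goodHom_sigInv, Algebra.TensorProduct.tmul_mul_tmul, one_mul]

theorem goodTransposition_monomial {n : ℤ} {h : Hq q} (hm : Hq.Monomial q n h) (a : A) :
    goodTransposition q α (h ⊗ₜ a) = (α ^ n) a ⊗ₜ h := by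
  rw [goodTransposition_tmul, goodHom_monomial α hm, rTensorHomToHomRTensor_apply]; rfl

theorem goodTransposition_comm_symm (z : A ⊗[k] Hq q) :
    goodTransposition q α (TensorProduct.comm k A (Hq q)
      (goodTransposition q α.symm (TensorProduct.comm k A (Hq q) z))) = z := by
  suffices H : goodTransposition q α ∘ₗ (TensorProduct.comm k A (Hq q)).toLinearMap ∘ₗ
      goodTransposition q α.symm ∘ₗ (TensorProduct.comm k A (Hq q)).toLinearMap =
      LinearMap.id from LinearMap.congr_fun H z
  apply TensorProduct.ext
  apply LinearMap.ext; intro a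
  apply Hq.linearMap_ext_monomial; intro n h hm
  simp [goodTransposition_monomial _ hm]
  rw [show α.symm = α⁻¹ from rfl, inv_zpow, ← AlgEquiv.mul_apply, mul_inv_cancel,
    AlgEquiv.one_apply]

/-- The inverse is the transposition attached to `α⁻¹`, conjugated by flips. -/
theorem goodTransposition_bijective : Function.Bijective (goodTransposition q α) := by
  constructor
  · have h : Function.LeftInverse (fun z => TensorProduct.comm k A (Hq q)
        (goodTransposition q α.symm (TensorProduct.comm k A (Hq q) z))) (goodTransposition q α) := by
      intro z
      have := goodTransposition_comm_symm (q := q) α.symm (TensorProduct.comm k (Hq q) A z)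
      rw [AlgEquiv.symm_symm, ← TensorProduct.comm_symm, LinearEquiv.symm_apply_apply] at this
      change TensorProduct.comm k A (Hq q) (goodTransposition q α.symm
        (TensorProduct.comm k A (Hq q) (goodTransposition q α z))) = z
      rw [← TensorProduct.comm_symm, LinearEquiv.symm_apply_eq]
      exact this
    exact h.injective
  · exact fun z => ⟨_, goodTransposition_comm_symm α z⟩

theorem slideH_monomial {i j : ℤ} {x y : Hq q} (hx : Hq.Monomial q i x) (hy : Hq.Monomial q j y)
    (a : A) : slideH (goodTransposition q α) (x ⊗ₜ (y ⊗ₜ a)) = (α ^ (i + j)) a ⊗ₜ (x ⊗ₜ y) := by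
  simp [slideH, goodTransposition_monomial _ hx, goodTransposition_monomial _ hy, zpow_add]

theorem slideA_monomial {n : ℤ} {h : Hq q} (hm : Hq.Monomial q n h) (a b : A) :
    slideA (goodTransposition q α) (h ⊗ₜ (a ⊗ₜ b)) = ((α ^ n) a ⊗ₜ (α ^ n) b) ⊗ₜ h := by
  simp [slideA, goodTransposition_monomial _ hm]

theorem isLeftTransposition_goodTransposition :
    IsLeftTransposition (goodTransposition q α) where
  bijective := goodTransposition_bijective α
  one_left a := by simpa using goodTransposition_monomial α (.one (q := q)) a
  mul_left := by
    apply TensorProduct.ext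
    apply Hq.linearMap_ext_monomial; intro i x hx
    apply TensorProduct.ext
    apply Hq.linearMap_ext_monomial; intro j y hy
    ext a
    simp [slideH_monomial _ hx hy, goodTransposition_monomial _ (hx.mul hy)]
  counit := by
    apply TensorProduct.ext
    apply Hq.linearMap_ext_monomial; intro n h hm
    ext a
    -- Either the weight is 0 and the twist is trivial, or both sides vanish.
    rcases hm.counit with rfl | h0
    · simp [goodTransposition_monomial _ hm]
    · simp [goodTransposition_monomial _ hm, h0]
  comul := by
    apply TensorProduct.ext
    apply Hq.linearMap_ext_monomial; intro n h hm
    ext a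
    simp only [LinearMap.compr₂ₛₗ_apply, TensorProduct.mk_apply, LinearMap.comp_apply,
      goodTransposition_monomial _ hm, LinearMap.lTensor_tmul, LinearMap.rTensor_tmul]
    have hc := hm.comul
    generalize Coalgebra.comul (R := k) h = z at hc ⊢
    induction hc using Submodule.span_induction with
    | zero => simp
    | add a b _ _ ha hb => simp only [TensorProduct.tmul_add, TensorProduct.add_tmul, map_add,
        ha, hb]
    | smul c a _ ha => simp only [TensorProduct.tmul_smul, ← TensorProduct.smul_tmul', map_smul, ha]
    | mem z hz =>
      obtain ⟨i, j, x, y, rfl, hx, hy, rfl⟩ := hz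
      simp [slideH_monomial _ hx hy]
  braid := by
    apply TensorProduct.ext
    apply Hq.linearMap_ext_monomial; intro i x hx
    apply TensorProduct.ext
    apply Hq.linearMap_ext_monomial; intro j y hy
    ext a
    simp [flipTensor, slideH_monomial _ hx hy, slideH_monomial _ hy hx, add_comm]
  one_right h := by
    have H : (TensorProduct.mk k A (Hq q) 1) =
        goodTransposition q α ∘ₗ (TensorProduct.mk k (Hq q) A).flip 1 := by
      apply Hq.linearMap_ext_monomial; intro n h hm
      simp [goodTransposition_monomial _ hm]
    exact (LinearMap.congr_fun H h).symm
  mul_right := by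
    apply TensorProduct.ext
    apply Hq.linearMap_ext_monomial; intro n h hm
    apply TensorProduct.ext'
    intro a b
    simp [slideA_monomial _ hm, goodTransposition_monomial _ hm]

end Good
end

noncomputable section

/-! ### Module algebra structures read on generators -/

section Good

variable {k A : Type*} [Field k] [Ring A] [Algebra k A] {q : kˣ} {α : A ≃ₐ[k] A}
  {ρ : Hq q →ₐ[k] Module.End k A}

theorem actionMap_tmul (h : Hq q) (a : A) : actionMap ρ (h ⊗ₜ a) = ρ h a := rfl

namespace IsBraidedModuleAlgebra

/-- The compatibility axiom at D₁ ⊗ h ⊗ a reads α(h·a) ⊗ D₁ = h·α(a) ⊗ D₁; a functional that is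
nonzero on `D₁` removes the second factor. -/
theorem map_action (H : IsBraidedModuleAlgebra (goodTransposition q α) ρ) (h : Hq q) (a : A) :
    α (ρ h a) = ρ h (α a) := by
  have h1 := LinearMap.congr_fun H.compat (Hq.D₁ q ⊗ₜ (h ⊗ₜ a))
  simp only [LinearMap.comp_apply, LinearMap.lTensor_tmul, actionMap_tmul, flipTensor,
    LinearEquiv.coe_coe, TensorProduct.assoc_symm_tmul, LinearMap.rTensor_tmul,
    TensorProduct.comm_tmul, TensorProduct.assoc_tmul, goodTransposition_D₁] at h1
  obtain ⟨φ, h2⟩ : ∃ φ : Module.Dual k (Hq q), φ (Hq.D₁ q) ≠ 0 := by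
    by_contra! h0
    exact Hq.D₁_ne_zero ((Module.forall_dual_apply_eq_zero_iff k _).mp h0)
  have h3 := congrArg ((TensorProduct.rid k A).toLinearMap ∘ₗ φ.lTensor A) h1
  simp at h3
  exact (smul_right_injective A h2) h3

theorem sig_mul (H : IsBraidedModuleAlgebra (goodTransposition q α) ρ) (a b : A) :
    ρ (Hq.sig q) (a * b) = ρ (Hq.sig q) a * ρ (Hq.sig q) b := by
  have h1 := LinearMap.congr_fun H.mul (Hq.sig q ⊗ₜ (a ⊗ₜ b))
  simpa [Hq.comul_eq, goodTransposition_sig, actionMap_tmul] using h1.symm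

theorem D₁_mul (H : IsBraidedModuleAlgebra (goodTransposition q α) ρ) (a b : A) :
    ρ (Hq.D₁ q) (a * b) = ρ (Hq.D₁ q) a * ρ (Hq.sig q) b + α a * ρ (Hq.D₁ q) b := by
  have h1 := LinearMap.congr_fun H.mul (Hq.D₁ q ⊗ₜ (a ⊗ₜ b))
  simpa [Hq.comul_eq, goodTransposition_sig, goodTransposition_D₁, actionMap_tmul,
    TensorProduct.add_tmul] using h1.symm

theorem D₂_mul (H : IsBraidedModuleAlgebra (goodTransposition q α) ρ) (a b : A) :
    ρ (Hq.D₂ q) (a * b) = ρ (Hq.D₂ q) a * b + ρ (Hq.sig q) (α.symm a) * ρ (Hq.D₂ q) b := by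
  have h1 := LinearMap.congr_fun H.mul (Hq.D₂ q ⊗ₜ (a ⊗ₜ b))
  have h2 : goodTransposition q α (1 ⊗ₜ a) = a ⊗ₜ 1 :=
    (isLeftTransposition_goodTransposition α).one_left a
  simpa [Hq.comul_eq, h2, goodTransposition_D₂, actionMap_tmul,
    TensorProduct.add_tmul] using h1.symm

theorem sig_one (H : IsBraidedModuleAlgebra (goodTransposition q α) ρ) :
    ρ (Hq.sig q) 1 = 1 := by
  simpa [Hq.counit_eq] using H.one (Hq.sig q)

end IsBraidedModuleAlgebra

/-- `h ⊗ h'` acts on `A ⊗ A` by `a ⊗ b ↦ (ρ ⊗ ρ)(h ⊗ s(h' ⊗ a) ⊗ b)`. -/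
def braidedDiagonal (hc : ∀ h a, α (ρ h a) = ρ h (α a)) :
    Hq q ⊗[k] Hq q →ₐ[k] Module.End k A ⊗[k] Module.End k A :=
  Algebra.TensorProduct.lift (Algebra.TensorProduct.includeLeft.comp ρ)
    ((Algebra.TensorProduct.map (AlgHom.id k _) ρ).comp (goodHom q α)) (by
      have hc' : ∀ h a, α.symm (ρ h a) = ρ h (α.symm a) := fun h a => by
        rw [AlgEquiv.symm_apply_eq, hc, AlgEquiv.apply_symm_apply]
      intro x y
      induction y using Hq.induction with
      | algebraMap c => rw [AlgHom.commutes]; exact Algebra.commute_algebraMap_right _ _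
      | mul a b ha hb => rw [map_mul]; exact ha.mul_right hb
      | add a b ha hb => rw [map_add]; exact ha.add_right hb
      | of y =>
        cases y
        · simp only [AlgHom.comp_apply, goodHom_D₁, Algebra.TensorProduct.map_tmul,
            Algebra.TensorProduct.includeLeft_apply, Commute, SemiconjBy,
            Algebra.TensorProduct.tmul_mul_tmul, one_mul, mul_one, AlgHom.id_apply]
          congr 1; ext a; exact (hc x a).symm
        · simp only [AlgHom.comp_apply, goodHom_D₂, Algebra.TensorProduct.map_tmul,
            Algebra.TensorProduct.includeLeft_apply, Commute, SemiconjBy,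
            Algebra.TensorProduct.tmul_mul_tmul, one_mul, mul_one, AlgHom.id_apply]
          congr 1; ext a; exact (hc' x a).symm
        · simp [AlgHom.comp_apply, goodHom_sig, Commute, SemiconjBy]
        · simp [AlgHom.comp_apply, goodHom_sigInv, Commute, SemiconjBy])

theorem braidedDiagonal_monomial (hc : ∀ h a, α (ρ h a) = ρ h (α a)) (x : Hq q) {n : ℤ} {y : Hq q}
    (hy : Hq.Monomial q n y) : braidedDiagonal hc (x ⊗ₜ y) =
      (ρ x * ((α ^ n : A ≃ₐ[k] A).toLinearMap : Module.End k A)) ⊗ₜ ρ y := by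
  simp [braidedDiagonal, goodHom_monomial _ hy]

/-- The action of `End A ⊗ End A` on `A ⊗ A`. -/
def tensorEnd (k A : Type*) [Field k] [Ring A] [Algebra k A] :
    Module.End k A ⊗[k] Module.End k A →ₐ[k] Module.End k (A ⊗[k] A) :=
  Module.endTensorEndAlgHom

@[simp] theorem tensorEnd_tmul (φ ψ : Module.End k A) (a b : A) :
    tensorEnd k A (φ ⊗ₜ ψ) (a ⊗ₜ b) = φ a ⊗ₜ ψ b := rfl

/-- Because the action commutes with `α`, the braided diagonal action of H_q ⊗ H_q is an algebra
homomorphism. The elements `h` for which multiplication of `A` intertwines it with `ρ h` are then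
closed under sums and products, so generators suffice. -/
theorem isBraidedModuleAlgebra_of_generators (hc : ∀ h a, α (ρ h a) = ρ h (α a))
    (sig_mul : ∀ a b, ρ (Hq.sig q) (a * b) = ρ (Hq.sig q) a * ρ (Hq.sig q) b)
    (D₁_mul : ∀ a b, ρ (Hq.D₁ q) (a * b) =
      ρ (Hq.D₁ q) a * ρ (Hq.sig q) b + α a * ρ (Hq.D₁ q) b)
    (D₂_mul : ∀ a b, ρ (Hq.D₂ q) (a * b) =
      ρ (Hq.D₂ q) a * b + ρ (Hq.sig q) (α.symm a) * ρ (Hq.D₂ q) b)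
    (sig_one : ρ (Hq.sig q) 1 = 1) (D₁_one : ρ (Hq.D₁ q) 1 = 0) (D₂_one : ρ (Hq.D₂ q) 1 = 0) :
    IsBraidedModuleAlgebra (goodTransposition q α) ρ where
  transposition := isLeftTransposition_goodTransposition α
  compat := by
    have hz : ∀ (n : ℤ) (h : Hq q) (a : A), (α ^ n) (ρ h a) = ρ h ((α ^ n) a) := by
      intro n h
      induction n using Int.induction_on with
      | zero => simp
      | succ n ih => intro a; rw [zpow_add_one, AlgEquiv.mul_apply, hc, ih, AlgEquiv.mul_apply]
      | pred n ih =>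
        intro a
        rw [zpow_sub_one, AlgEquiv.mul_apply, AlgEquiv.mul_apply, ← ih]
        congr 1
        change α.symm _ = _
        rw [AlgEquiv.symm_apply_eq, hc]
        congr 1
        exact (AlgEquiv.apply_symm_apply α a).symm
    apply TensorProduct.ext
    apply Hq.linearMap_ext_monomial; intro n x hx
    apply TensorProduct.ext'
    intro h a
    simp [flipTensor, goodTransposition_monomial _ hx, actionMap_tmul, hz]
  mul := by
    have key : ∀ h : Hq q, LinearMap.mul' k A ∘ₗ
        tensorEnd k A (braidedDiagonal hc (Hq.comulHom q h)) =
        ρ h ∘ₗ LinearMap.mul' k A := by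
      intro h
      induction h using Hq.induction with
      | algebraMap c =>
        rw [AlgHom.commutes, AlgHom.commutes, AlgHom.commutes, AlgHom.commutes]
        apply TensorProduct.ext'
        intro a b
        simp [Module.algebraMap_end_apply]
      | add a b ha hb => simp only [map_add, LinearMap.comp_add, LinearMap.add_comp, ha, hb]
      | mul a b ha hb =>
        simp only [map_mul, Module.End.mul_eq_comp]
        rw [← LinearMap.comp_assoc, ha, LinearMap.comp_assoc, hb, LinearMap.comp_assoc]
      | of x =>
        have hD₁ : Hq.Monomial q 1 (Hq.D₁ q) := by simpa using (Hq.Monomial.one (q := q)).D₁_mul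
        have hD₂ : Hq.Monomial q (-1) (Hq.D₂ q) := by
          simpa using (Hq.Monomial.one (q := q)).D₂_mul
        have hs : Hq.Monomial q 0 (Hq.sig q) := by simpa using (Hq.Monomial.one (q := q)).sig_mul
        have ht : Hq.Monomial q 0 (Hq.sigInv q) := by
          simpa using (Hq.Monomial.one (q := q)).sigInv_mul
        apply TensorProduct.ext'
        intro a b
        cases x
        · rw [Hq.comulHom_D₁, map_add, braidedDiagonal_monomial hc _ hs,
            braidedDiagonal_monomial hc _ hD₁]
          simp [D₁_mul]
        · rw [Hq.comulHom_D₂, map_add, braidedDiagonal_monomial hc _ .one,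
            braidedDiagonal_monomial hc _ hD₂]
          simp [D₂_mul]
        · rw [Hq.comulHom_sig, braidedDiagonal_monomial hc _ hs]
          simp [sig_mul]
        · rw [Hq.comulHom_sigInv, braidedDiagonal_monomial hc _ ht]
          have h1 : ∀ a, ρ (Hq.sig q) (ρ (Hq.sigInv q) a) = a := fun a => by
            rw [← Module.End.mul_apply, ← map_mul, Hq.sig_mul_sigInv, map_one]; rfl
          have h2 : ∀ a, ρ (Hq.sigInv q) (ρ (Hq.sig q) a) = a := fun a => by
            rw [← Module.End.mul_apply, ← map_mul, Hq.sigInv_mul_sig, map_one]; rfl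
          simp
          -- The action of `σ⁻¹` is multiplicative because it inverts a multiplicative map.
          rw [← h2 (_ * _), sig_mul, h1, h1]
    apply TensorProduct.ext'
    intro h z
    induction z with
    | zero => simp
    | add x y hx hy => simp only [TensorProduct.tmul_add, map_add, hx, hy]
    | tmul a b =>
    have hk := LinearMap.congr_fun (key h) (a ⊗ₜ b)
    simp only [LinearMap.comp_apply, LinearMap.lTensor_tmul,
      LinearMap.rTensor_tmul, actionMap_tmul] at hk ⊢
    rw [← hk, Hq.comul_eq]
    generalize Hq.comulHom q h = z
    induction z with
    | zero => simp
    | add x y hx hy => simp only [map_add, TensorProduct.add_tmul, LinearMap.add_apply, hx, hy]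
    | tmul x y =>
      have hy := Hq.span_monomial y
      induction hy using Submodule.span_induction with
      | zero => simp
      | add y z _ _ hy hz => simp only [map_add, TensorProduct.add_tmul, TensorProduct.tmul_add,
          LinearMap.add_apply, hy, hz]
      | smul c y _ hy =>
        simp only [TensorProduct.tmul_smul, ← TensorProduct.smul_tmul', map_smul,
          LinearMap.smul_apply, hy]
      | mem y hy =>
        obtain ⟨n, hy⟩ := hy
        rw [braidedDiagonal_monomial hc _ hy]
        simp [goodTransposition_monomial _ hy, actionMap_tmul]
  one h := by
    rw [Hq.counit_eq]
    have h1 : ρ (Hq.sigInv q) 1 = 1 := by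
      conv_lhs => rw [← sig_one]
      rw [← Module.End.mul_apply, ← map_mul, Hq.sigInv_mul_sig, map_one ρ]; rfl
    induction h using Hq.induction with
    | algebraMap c => simp
    | add a b ha hb => simp [ha, hb, add_smul]
    | mul a b ha hb => rw [map_mul, map_mul, Module.End.mul_apply, hb, map_smul, ha, smul_smul, mul_comm]
    | of x => cases x <;> simp [sig_one, D₁_one, D₂_one, h1]

end Good
end

noncomputable section

/-! ### Maps out of the symmetric algebra -/

namespace SymmetricAlgebra

variable {k V : Type*} [Field k] [AddCommGroup V] [Module k V]

/-- A functional on `V` extends to an algebra map S(V) → k[X] sending v to φ(v)X, and functionals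
separate vectors. -/
theorem ι_injective_of_field : Function.Injective (ι k V) := by
  rw [injective_iff_map_eq_zero]
  intro v hv
  rw [← Module.forall_dual_apply_eq_zero_iff k]
  intro φ
  have h := congrArg (lift ((LinearMap.toSpanSingleton k (Polynomial k) Polynomial.X) ∘ₗ φ)) hv
  simpa using h

open scoped IsMulCommutative in
/-- A linear map to an algebra whose values commute with each other extends to an algebra
homomorphism. -/
theorem exists_algHom_of_commute {B : Type*} [Ring B] [Algebra k B] (F : V →ₗ[k] B)
    (hF : ∀ u v, F u * F v = F v * F u) :
    ∃ E : SymmetricAlgebra k V →ₐ[k] B, ∀ v, E (ι k V v) = F v := by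
  let S : Subalgebra k B := Algebra.adjoin k (Set.range F)
  have : IsMulCommutative S :=
    Algebra.isMulCommutative_adjoin k (by rintro _ ⟨u, rfl⟩ _ ⟨v, rfl⟩; exact hF u v)
  let F' : V →ₗ[k] S :=
    F.codRestrict (Subalgebra.toSubmodule S) fun v => Algebra.subset_adjoin ⟨v, rfl⟩
  exact ⟨S.val.comp (lift (A := S) F'), fun v => by
    rw [AlgHom.comp_apply, lift_ι_apply]; rfl⟩

theorem span_prod_ι (P : SymmetricAlgebra k V) :
    P ∈ Submodule.span k {P | ∃ (m : ℕ) (v : Fin m → V), ∏ i, ι k V (v i) = P} := by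
  suffices H : ∀ x ∈ Submodule.span k {P | ∃ (m : ℕ) (v : Fin m → V), ∏ i, ι k V (v i) = P},
      P * x ∈ Submodule.span k {P | ∃ (m : ℕ) (v : Fin m → V), ∏ i, ι k V (v i) = P} by
    simpa using H 1 (Submodule.subset_span ⟨0, 0, by simp⟩)
  induction P using SymmetricAlgebra.induction with
  | algebraMap c => intro x hx; rw [← Algebra.smul_def]; exact Submodule.smul_mem _ _ hx
  | mul a b ha hb => intro x hx; rw [mul_assoc]; exact ha _ (hb _ hx)
  | add a b ha hb => intro x hx; rw [add_mul]; exact add_mem (ha _ hx) (hb _ hx)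
  | ι u =>
    intro x hx
    induction hx using Submodule.span_induction with
    | zero => simp
    | add a b _ _ ha hb => rw [mul_add]; exact add_mem ha hb
    | smul c a _ ha => rw [mul_smul_comm]; exact Submodule.smul_mem _ _ ha
    | mem x hx =>
      obtain ⟨m, v, rfl⟩ := hx
      exact Submodule.subset_span ⟨m + 1, Fin.cons u v, by simp [Fin.prod_univ_succ]⟩

end SymmetricAlgebra

/-! ### Generators of the crossed product -/

namespace CrossedProduct

open SymmetricAlgebra

variable {k G V : Type*} [Field k] [Group G] [AddCommGroup V] [Module k V]
  {r : Representation k G V} {f : NormalCocycle G k}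

theorem single_injective (g : G) : Function.Injective (single r f g) := Finsupp.single_injective g

theorem eq_of_single_eq_single {g h : G} {P Q : SymmetricAlgebra k V} (hP : P ≠ 0)
    (H : single r f g P = single r f h Q) : g = h ∧ P = Q := by
  rcases (Finsupp.single_eq_single_iff (M := SymmetricAlgebra k V) g h P Q).mp H with h | h
  · exact h
  · exact absurd h.1 hP

variable (r f) in
/-- The inclusion `S(V) ⊆ A`. -/
def ofS : SymmetricAlgebra k V →ₐ[k] CrossedProduct r f :=
  AlgHom.ofLinearMap (single r f 1) rfl fun P Q => by
    rw [single_mul_single, map_one, f.one_left, Module.End.one_eq_id, symMap_id, mul_one,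
      Units.val_one, one_smul]

theorem single_one_eq (P : SymmetricAlgebra k V) : single r f 1 P = ofS r f P := rfl

theorem ofS_ι (v : V) : ofS r f (ι k V v) = ofV r f v := rfl

theorem single_eq (g : G) (P : SymmetricAlgebra k V) : single r f g P = ofS r f P * w r f g := by
  rw [← single_one_eq, w, single_mul_single, map_one (symMap _), f.one_left, mul_one, one_mul,
    Units.val_one, one_smul]

theorem w_one : w r f 1 = 1 := rfl

theorem w_mul_ofS (g : G) (P : SymmetricAlgebra k V) :
    w r f g * ofS r f P = ofS r f (symMap (r g) P) * w r f g := by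
  rw [← single_eq, ← single_one_eq, w, single_mul_single, f.one_right, mul_one, one_mul,
    Units.val_one, one_smul]

theorem w_mul_ofV (g : G) (v : V) : w r f g * ofV r f v = ofV r f (r g v) * w r f g := by
  rw [← ofS_ι, w_mul_ofS, symMap_ι]; rfl

theorem w_mul_w (g h : G) : w r f g * w r f h = (f g h : k) • w r f (g * h) := by
  rw [w, w, single_mul_single, map_one, mul_one]; rfl

@[elab_as_elim]
theorem induction_generators {motive : CrossedProduct r f → Prop} (a : CrossedProduct r f)
    (algebraMap : ∀ c, motive (algebraMap k _ c)) (add : ∀ a b, motive a → motive b → motive (a + b))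
    (mul : ∀ a b, motive a → motive b → motive (a * b))
    (ofV : ∀ v, motive (ofV r f v)) (w : ∀ g, motive (w r f g)) : motive a := by
  induction a using induction_on with
  | zero => simpa using algebraMap 0
  | add a b ha hb => exact add _ _ ha hb
  | single g P =>
    rw [single_eq]
    refine mul _ _ ?_ (w g)
    induction P using SymmetricAlgebra.induction with
    | algebraMap c => rw [AlgHom.commutes]; exact algebraMap c
    | ι v => exact ofV v
    | mul a b ha hb => rw [map_mul]; exact mul _ _ ha hb
    | add a b ha hb => rw [map_add]; exact add _ _ ha hb

theorem linearMap_ext_prod {M : Type*} [AddCommGroup M] [Module k M]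
    {φ ψ : CrossedProduct r f →ₗ[k] M}
    (H : ∀ (m : ℕ) (v : Fin m → V) (g : G), φ (single r f g (∏ i, ι k V (v i))) =
      ψ (single r f g (∏ i, ι k V (v i)))) : φ = ψ := by
  ext a
  induction a using induction_on with
  | zero => simp
  | add a b ha hb => simp [ha, hb]
  | single g P =>
    have hP := span_prod_ι P
    induction hP using Submodule.span_induction with
    | zero => simp
    | add a b _ _ ha hb => simp [ha, hb]
    | smul c a _ ha => simp [ha]
    | mem P hP => obtain ⟨m, v, rfl⟩ := hP; exact H m v g

/-! ### Existence and uniqueness of skew extensions -/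

section SkewExtension

variable {a b : CrossedProduct r f →ₗ[k] CrossedProduct r f} {δ' : V →ₗ[k] CrossedProduct r f}
  {δ : Module.End k (CrossedProduct r f)} {c : k} {a' : SymmetricAlgebra k V →ₐ[k] CrossedProduct r f}

theorem IsSkewExtension.unique {δ₁ δ₂ : Module.End k (CrossedProduct r f)}
    (h₁ : IsSkewExtension a b δ' δ₁) (h₂ : IsSkewExtension a b δ' δ₂) : δ₁ = δ₂ :=
  linearMap_ext_prod fun m v g => by rw [h₁, h₂]

theorem IsSkewExtension.apply_w (h : IsSkewExtension a b δ' δ) (g : G) : δ (w r f g) = 0 := by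
  simpa [w] using h 0 Fin.elim0 g

/-- Splitting off the term j = 0 turns the sum formula into a recursion on the first letter. The
scalar `c` will be χ(1), which need not be 1 while χ is only a map. -/
theorem sum_skew_succ (ha : ∀ P, a (single r f 1 P) = c • a' P) (m : ℕ) (v : Fin (m + 1) → V) (g : G) :
    ∑ j, a (single r f 1 (∏ i ∈ Finset.Iio j, ι k V (v i))) * δ' (v j) *
        b (single r f g (∏ i ∈ Finset.Ioi j, ι k V (v i))) =
      c • (δ' (v 0) * b (single r f g (∏ i : Fin m, ι k V (v i.succ)))) + a' (ι k V (v 0)) *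
        ∑ j : Fin m, a (single r f 1 (∏ i ∈ Finset.Iio j, ι k V (v i.succ))) * δ' (v j.succ) *
        b (single r f g (∏ i ∈ Finset.Ioi j, ι k V (v i.succ))) := by
  have h0 : ∀ j : Fin m, ∏ i ∈ Finset.Iio j.succ, ι k V (v i) =
      ι k V (v 0) * ∏ i ∈ Finset.Iio j, ι k V (v i.succ) := by
    intro j
    have : Finset.Iio j.succ = insert 0 ((Finset.Iio j).map (Fin.succEmb m)) := by
      ext i
      cases i using Fin.cases <;> simp
    rw [this, Finset.prod_insert (by simp), Finset.prod_map]
    rfl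
  rw [Fin.sum_univ_succ, Finset.mul_sum]
  congr 1
  · have h1 : ∏ i ∈ Finset.Ioi (0 : Fin (m + 1)), ι k V (v i) = ∏ i : Fin m, ι k V (v i.succ) := by
      rw [Fin.Ioi_zero_eq_map, Finset.prod_map]; rfl
    have h2 : Finset.Iio (0 : Fin (m + 1)) = ∅ := by ext; simp
    rw [h1, h2, Finset.prod_empty, ha, map_one, smul_mul_assoc, smul_mul_assoc, one_mul]
  · refine Finset.sum_congr rfl fun j _ => ?_
    rw [h0, Fin.prod_Ioi_succ, ha, ha, map_mul]
    simp only [smul_mul_assoc, mul_smul_comm, mul_assoc]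

theorem isSkewExtension_of_step (ha : ∀ P, a (single r f 1 P) = c • a' P)
    (hw : ∀ g, δ (w r f g) = 0)
    (hv : ∀ v g P, δ (single r f g (ι k V v * P)) =
      c • (δ' v * b (single r f g P)) + a' (ι k V v) * δ (single r f g P)) :
    IsSkewExtension a b δ' δ := by
  intro m v g
  induction m with
  | zero => simpa [w] using hw g
  | succ m ih => rw [sum_skew_succ ha, ← ih, Fin.prod_univ_succ, hv]

theorem IsSkewExtension.step (h : IsSkewExtension a b δ' δ)
    (ha : ∀ P, a (single r f 1 P) = c • a' P) (v : V) (g : G) (P : SymmetricAlgebra k V) :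
    δ (single r f g (ι k V v * P)) =
      c • (δ' v * b (single r f g P)) + a' (ι k V v) * δ (single r f g P) := by
  have hP := span_prod_ι P
  induction hP using Submodule.span_induction with
  | zero => simp
  | add P Q _ _ hP hQ => simp only [mul_add, map_add, hP, hQ, smul_add]; abel
  | smul d P _ hP => simp only [mul_smul_comm, map_smul, hP, smul_add, smul_comm c d]
  | mem P hP =>
    obtain ⟨m, u, rfl⟩ := hP
    have h1 := h (m + 1) (Fin.cons v u) g
    rw [sum_skew_succ ha, Fin.prod_univ_succ] at h1
    simpa [h m u g] using h1

/-- A skew derivation is the off-diagonal entry of an upper triangular representation whose diagonal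
entries are the two twisting homomorphisms. The hypothesis `H` says exactly that the off-diagonal
entries of the matrices of `u` and `v` commute as required for an extension to S(V). -/
theorem exists_isSkewExtension (ha : ∀ P, a (single r f 1 P) = c • a' P) {χ : G → kˣ}
    {b' : SymmetricAlgebra k V →ₐ[k] SymmetricAlgebra k V}
    (hb : ∀ g P, b (single r f g P) = (χ g : k) • single r f g (b' P))
    (H : ∀ u v, a' (ι k V u) * δ' v + δ' u * ofS r f (b' (ι k V v)) =
      a' (ι k V v) * δ' u + δ' v * ofS r f (b' (ι k V u))) :
    ∃ δ, IsSkewExtension a b δ' δ := by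
  let F : V →ₗ[k] Matrix (Fin 2) (Fin 2) (CrossedProduct r f) :=
    { toFun := fun v => !![a' (ι k V v), δ' v; 0, ofS r f (b' (ι k V v))]
      map_add' := fun u v => by ext i j; fin_cases i <;> fin_cases j <;> simp
      map_smul' := fun c v => by ext i j; fin_cases i <;> fin_cases j <;> simp }
  have hF : ∀ v, F v = !![a' (ι k V v), δ' v; 0, ofS r f (b' (ι k V v))] := fun v => rfl
  obtain ⟨E, hE⟩ := exists_algHom_of_commute F (fun u v => by
    rw [hF, hF, Matrix.mul_fin_two, Matrix.mul_fin_two]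
    simp only [mul_zero, zero_mul, add_zero, zero_add, H u v, ← map_mul, mul_comm (ι k V u)])
  have hE0 : ∀ P, E P 1 0 = 0 ∧ E P 1 1 = ofS r f (b' P) := by
    intro P
    induction P using SymmetricAlgebra.induction with
    | algebraMap c =>
      simp only [AlgHom.commutes, Matrix.algebraMap_matrix_apply]; simp
    | ι v => simp [hE, hF]
    | mul P Q hP hQ => simp [Matrix.mul_apply, hP, hQ]
    | add P Q hP hQ => simp [hP, hQ]
  -- Each summand of the skew formula has one factor from `a`, contributing `c`, and one from `b`,
  -- contributing `χ g`.
  let δ : Module.End k (CrossedProduct r f) := lsum r f fun g => ((c * χ g : k)) •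
    ((LinearMap.mulRight k (w r f g)) ∘ₗ Matrix.entryLinearMap k _ 0 1 ∘ₗ E.toLinearMap)
  have hδ : ∀ g P, δ (single r f g P) = (c * χ g : k) • (E P 0 1 * w r f g) := by
    intro g P; simp [δ]
  refine ⟨δ, isSkewExtension_of_step ha (fun g => ?_) fun v g P => ?_⟩
  · rw [w, hδ, map_one]; simp
  · rw [hδ, hδ, hb, map_mul, Matrix.mul_apply, Fin.sum_univ_two, (hE0 P).2, hE, hF, single_eq]
    simp [add_mul, mul_assoc, mul_smul, add_comm]

end SkewExtension

end CrossedProduct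

end

noncomputable section

/-! ### Diagonal maps and skew derivations -/

namespace CrossedProduct

open SymmetricAlgebra

variable {k G V : Type*} [Field k] [Group G] [AddCommGroup V] [Module k V]
  {r : Representation k G V} {f : NormalCocycle G k}

theorem diagMap_w (φ : V →ₗ[k] V) (χ : G → kˣ) (g : G) :
    diagMap r f φ χ (w r f g) = (χ g : k) • w r f g := by
  rw [w, diagMap_single, map_one]

theorem diagMap_single_one (φ : V →ₗ[k] V) (χ : G → kˣ) (P : SymmetricAlgebra k V) :
    diagMap r f φ χ (single r f 1 P) = (χ 1 : k) • ((ofS r f).comp (symMap φ)) P := by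
  rw [diagMap_single, single_one_eq, AlgHom.comp_apply]

theorem diagMap_ofS (φ : V →ₗ[k] V) (χ : G →* kˣ) (P : SymmetricAlgebra k V) :
    diagMap r f φ χ (ofS r f P) = ofS r f (symMap φ P) := by
  rw [← single_one_eq, diagMap_single_one, map_one, Units.val_one, one_smul, AlgHom.comp_apply]

theorem diagMap_ofV (φ : V →ₗ[k] V) (χ : G →* kˣ) (v : V) :
    diagMap r f φ χ (ofV r f v) = ofV r f (φ v) := by
  rw [← ofS_ι, diagMap_ofS, symMap_ι]; rfl

theorem diagMap_mul {φ : V →ₗ[k] V} (hφ : ∀ g v, φ (r g v) = r g (φ v)) (χ : G →* kˣ)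
    (a b : CrossedProduct r f) :
    diagMap r f φ χ (a * b) = diagMap r f φ χ a * diagMap r f φ χ b := by
  induction a using induction_on with
  | zero => simp
  | add a b ha hb => simp only [map_add, add_mul, ha, hb]
  | single g P =>
  induction b using induction_on with
  | zero => simp
  | add a b ha hb => simp only [map_add, mul_add, ha, hb]
  | single h Q =>
    have e : φ ∘ₗ r g = r g ∘ₗ φ := by ext v; simp [hφ]
    simp only [diagMap_single, single_mul_single, map_smul, smul_mul_assoc, mul_smul_comm,
      map_mul, symMap_symMap, e, smul_smul, Units.val_mul]
    congr 1
    ring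

theorem diagMap_id : diagMap r f LinearMap.id (1 : G →* kˣ) = LinearMap.id := by
  ext a
  induction a using induction_on with
  | zero => simp
  | add a b ha hb => simp only [map_add, ha, hb]
  | single g P => simp [symMap_id]

theorem diagMap_comp (φ ψ : V →ₗ[k] V) (χ χ' : G → kˣ) :
    diagMap r f φ χ ∘ₗ diagMap r f ψ χ' = diagMap r f (φ ∘ₗ ψ) (χ * χ') := by
  ext a
  induction a using induction_on with
  | zero => simp
  | add a b ha hb => simp only [map_add, ha, hb]
  | single g P => simp [symMap_symMap, smul_smul, mul_comm]

theorem ofV_injective : Function.Injective (ofV r f) :=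
  (single_injective 1).comp ι_injective_of_field

theorem symMap_injective {φ : V →ₗ[k] V} (ψ : V →ₗ[k] V) (h : ψ ∘ₗ φ = LinearMap.id) :
    Function.Injective (symMap φ) :=
  Function.LeftInverse.injective (g := symMap ψ) fun P => by rw [symMap_symMap, h, symMap_id]

theorem symMap_rep_injective (g : G) : Function.Injective (symMap (r g)) :=
  symMap_injective (r g⁻¹) (by rw [← Module.End.mul_eq_comp, ← map_mul, inv_mul_cancel, map_one]; rfl)

/-- `δ` is an `(a, b)`-skew derivation. -/
def IsSkewDerivation (a b δ : Module.End k (CrossedProduct r f)) : Prop :=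
  ∀ x y, δ (x * y) = δ x * b y + a x * δ y

/-- Both F = δβ and F = cβδ satisfy F(xy) = F(x)·βb(y) + βa(x)·F(y), so agreement on generators
propagates. -/
theorem IsSkewDerivation.commute {a b δ : Module.End k (CrossedProduct r f)}
    (hδ : IsSkewDerivation a b δ) (hw : ∀ g, δ (w r f g) = 0)
    (β : CrossedProduct r f →ₐ[k] CrossedProduct r f) (c : k) (ha : ∀ x, a (β x) = β (a x))
    (hb : ∀ x, b (β x) = β (b x)) (hβV : ∀ v, δ (β (ofV r f v)) = c • β (δ (ofV r f v)))
    (hβw : ∀ g, δ (β (w r f g)) = 0) (x : CrossedProduct r f) : δ (β x) = c • β (δ x) := by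
  induction x using induction_generators with
  | algebraMap d =>
    rw [AlgHom.commutes, Algebra.algebraMap_eq_smul_one, ← w_one, map_smul, hw]; simp
  | add x y hx hy => simp only [map_add, hx, hy, smul_add]
  | mul x y hx hy =>
    rw [map_mul, hδ, hδ, hx, hy, ha, hb, map_add, map_mul, map_mul, smul_add, smul_mul_assoc,
      mul_smul_comm]
  | ofV v => exact hβV v
  | w g => rw [hβw, hw, map_zero, smul_zero]

section

variable {φ ψ : V →ₗ[k] V} {χ χ' : G →* kˣ} {δ' : V →ₗ[k] CrossedProduct r f}
  {δ : Module.End k (CrossedProduct r f)} {x : V} {g₀ : G} {P : SymmetricAlgebra k V}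

theorem exists_sub_smul_mem_ker (hcodim : Module.finrank k (V ⧸ LinearMap.ker δ') = 1)
    (hx : x ∉ LinearMap.ker δ') (v : V) : ∃ c : k, v - c • x ∈ LinearMap.ker δ' := by
  have h0 : (LinearMap.ker δ').mkQ x ≠ 0 := by simpa using hx
  obtain ⟨c, hc⟩ := (finrank_eq_one_iff_of_nonzero' _ h0).mp hcodim ((LinearMap.ker δ').mkQ v)
  refine ⟨c, ?_⟩
  rw [← Submodule.ker_mkQ (LinearMap.ker δ'), LinearMap.mem_ker, map_sub, map_smul, hc, sub_self]

theorem exists_isSkewExtension_diagMap {χ χ' : G → kˣ}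
    (hcodim : Module.finrank k (V ⧸ LinearMap.ker δ') = 1) (hx : x ∉ LinearMap.ker δ')
    (hδx : δ' x = single r f g₀ P) (H : ∀ v ∈ LinearMap.ker δ', φ v = r g₀ (ψ v)) :
    ∃! δ, IsSkewExtension (diagMap r f φ χ) (diagMap r f ψ χ') δ' δ := by
  have hex : ∃ δ, IsSkewExtension (diagMap r f φ χ) (diagMap r f ψ χ') δ' δ := by
    refine exists_isSkewExtension (diagMap_single_one φ χ) (diagMap_single ψ χ') fun u v => ?_
    obtain ⟨c, hc⟩ := exists_sub_smul_mem_ker hcodim hx u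
    obtain ⟨d, hd⟩ := exists_sub_smul_mem_ker hcodim hx v
    have hu : δ' u = c • (ofS r f P * w r f g₀) := by
      rw [LinearMap.mem_ker, map_sub, map_smul, sub_eq_zero, hδx, single_eq] at hc; exact hc
    have hv : δ' v = d • (ofS r f P * w r f g₀) := by
      rw [LinearMap.mem_ker, map_sub, map_smul, sub_eq_zero, hδx, single_eq] at hd; exact hd
    -- The defect of φ = g₀ψ factors through the quotient by the kernel, hence is proportional to
    -- its value at `x`. In the commutation identity it enters with coefficient cd, symmetric in `u`
    -- and `v`, and cancels.
    have hu' : φ u = r g₀ (ψ u) + c • (φ x - r g₀ (ψ x)) := by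
      have := H _ hc
      simp only [map_sub, map_smul] at this
      rw [sub_eq_iff_eq_add] at this
      rw [this, smul_sub]; abel
    have hv' : φ v = r g₀ (ψ v) + d • (φ x - r g₀ (ψ x)) := by
      have := H _ hd
      simp only [map_sub, map_smul] at this
      rw [sub_eq_iff_eq_add] at this
      rw [this, smul_sub]; abel
    simp only [AlgHom.comp_apply, symMap_ι, hu, hv, smul_mul_assoc, mul_smul_comm, mul_assoc,
      w_mul_ofS]
    simp only [← mul_assoc, ← map_mul, ← smul_mul_assoc, ← map_smul (ofS r f), ← add_mul,
      ← map_add (ofS r f)]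
    congr 2
    rw [hu', hv']
    simp only [map_add, map_smul, Algebra.smul_def]
    ring
  exact hex.imp fun δ hδ => ⟨hδ, fun _ h => h.unique hδ⟩

theorem IsSkewDerivation.isSkewExtension
    (hδ : IsSkewDerivation (diagMap r f φ χ) (diagMap r f ψ χ') δ)
    (hV : ∀ v, δ (ofV r f v) = δ' v) (hw : ∀ g, δ (w r f g) = 0) :
    IsSkewExtension (diagMap r f φ χ) (diagMap r f ψ χ') δ' δ := by
  refine isSkewExtension_of_step (diagMap_single_one φ χ) hw fun v g Q => ?_
  rw [single_eq, map_mul (ofS r f), mul_assoc, ← single_eq, ofS_ι, hδ, hV, diagMap_ofV, map_one,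
    Units.val_one, one_smul, AlgHom.comp_apply, symMap_ι, ofS_ι]

theorem IsSkewExtension.apply_ofV {χ χ' : G →* kˣ}
    (h : IsSkewExtension (diagMap r f φ χ) (diagMap r f ψ χ') δ' δ) (v : V) :
    δ (ofV r f v) = δ' v := by
  have h1 := h.step (diagMap_single_one φ χ) v 1 1
  rw [mul_one] at h1
  have h2 : δ (single r f 1 1) = 0 := h.apply_w 1
  have h3 : diagMap r f ψ χ' (single r f 1 1) = 1 := by
    rw [diagMap_single, map_one, map_one, Units.val_one, one_smul]; rfl
  rw [h2, h3, map_one, Units.val_one, one_smul, mul_one, mul_zero, add_zero] at h1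
  exact h1

/-- The sum formula gives the Leibniz rule for a left factor in `V`. For a left factor w_g, moving
w_g past the letters of the right factor one at a time uses `hrel` at each step. The rule then
extends to products of generators. -/
theorem IsSkewExtension.isSkewDerivation (hφ : ∀ g v, φ (r g v) = r g (φ v))
    (hψ : ∀ g v, ψ (r g v) = r g (ψ v))
    (h : IsSkewExtension (diagMap r f φ χ) (diagMap r f ψ χ') δ' δ)
    (hrel : ∀ g v, δ' (r g v) * ((χ' g : k) • w r f g) = (χ g : k) • w r f g * δ' v) :
    IsSkewDerivation (diagMap r f φ χ) (diagMap r f ψ χ') δ := by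
  have hv : ∀ v y, δ (ofV r f v * y) =
      δ' v * diagMap r f ψ χ' y + diagMap r f φ χ (ofV r f v) * δ y := by
    intro v y
    induction y using induction_on with
    | zero => simp
    | add x y hx hy => simp only [mul_add, map_add, hx, hy]; abel
    | single g Q =>
      have h1 := h.step (diagMap_single_one φ χ) v g Q
      rw [map_one, Units.val_one, one_smul, AlgHom.comp_apply, symMap_ι, ofS_ι, single_eq,
        map_mul (ofS r f), mul_assoc, ← single_eq, ofS_ι] at h1
      rw [h1, diagMap_ofV]
  have hS : ∀ Q y, (∀ g, δ (w r f g * y) = diagMap r f φ χ (w r f g) * δ y) → ∀ g,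
      δ (w r f g * (ofS r f Q * y)) = diagMap r f φ χ (w r f g) * δ (ofS r f Q * y) := by
    intro Q
    induction Q using SymmetricAlgebra.induction with
    | algebraMap c =>
      intro y hy g
      simp only [AlgHom.commutes, ← Algebra.smul_def, mul_smul_comm, map_smul, hy]
    | add a b ha hb => intro y hy g; simp only [map_add, add_mul, mul_add, ha y hy, hb y hy]
    | mul a b ha hb =>
      intro y hy g
      rw [map_mul (ofS r f), mul_assoc]
      exact ha _ (hb _ hy) g
    | ι v =>
      intro y hy g
      rw [ofS_ι, ← mul_assoc, w_mul_ofV, mul_assoc, hv, hv, hy, diagMap_mul hψ, ← mul_assoc,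
        diagMap_w, hrel, ← diagMap_w φ, ← mul_assoc, ← diagMap_mul hφ, ← w_mul_ofV, diagMap_mul hφ,
        mul_add, mul_assoc, mul_assoc]
  have hw : ∀ g y, δ (w r f g * y) = diagMap r f φ χ (w r f g) * δ y := by
    intro g y
    induction y using induction_on with
    | zero => simp
    | add x y hx hy => simp only [mul_add, map_add, hx, hy]
    | single l Q =>
      rw [single_eq]
      refine hS _ _ (fun g => ?_) g
      rw [w_mul_w, map_smul, h.apply_w, h.apply_w, smul_zero, mul_zero]
  intro x
  induction x using induction_generators with
  | algebraMap c =>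
    intro y
    simp only [Algebra.algebraMap_eq_smul_one, ← w_one, map_smul, smul_mul_assoc, h.apply_w, hw]
    simp
  | add x y hx hy => intro z; simp only [add_mul, map_add, hx, hy]; abel
  | mul x y hx hy =>
    intro z
    rw [mul_assoc, hx, hy, hx, diagMap_mul hψ, diagMap_mul hφ]
    simp only [add_mul, mul_add, mul_assoc, add_assoc]
  | ofV v => intro y; rw [hv, h.apply_ofV]
  | w g => intro y; rw [hw, h.apply_w, zero_mul, zero_add]

end

end CrossedProduct

end

noncomputable section

/-! ### Leibniz rule against the relations of the crossed product -/

namespace CrossedProduct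

open SymmetricAlgebra

variable {k G V : Type*} [Field k] [Group G] [AddCommGroup V] [Module k V]
  {r : Representation k G V} {f : NormalCocycle G k}
  {φ ψ : V →ₗ[k] V} {χ χ' : G →* kˣ} {δ' : V →ₗ[k] CrossedProduct r f}
  {δ : Module.End k (CrossedProduct r f)} {x : V} {g₀ : G} {P : SymmetricAlgebra k V}

theorem ne_zero_of_notMem_ker (hx : x ∉ LinearMap.ker δ') (hδx : δ' x = single r f g₀ P) :
    P ≠ 0 := by
  rintro rfl
  exact hx (by rw [LinearMap.mem_ker, hδx, map_zero])

/-- Applying δ to vx = xv with δ(v) = 0 leaves φ(v)P w_{g₀} = P w_{g₀}ψ(v); moving w_{g₀} to the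
right and cancelling `P` in the domain S(V) gives the claim. -/
theorem IsSkewDerivation.twist_of_mem_ker
    (hδ : IsSkewDerivation (diagMap r f φ χ) (diagMap r f ψ χ') δ)
    (hV : ∀ v, δ (ofV r f v) = δ' v) (hx : x ∉ LinearMap.ker δ') (hδx : δ' x = single r f g₀ P)
    {v : V} (hv : v ∈ LinearMap.ker δ') : φ v = r g₀ (ψ v) := by
  have h1 : δ (ofV r f v * ofV r f x) = δ (ofV r f x * ofV r f v) := by
    rw [← ofS_ι, ← ofS_ι, ← map_mul (ofS r f), ← map_mul (ofS r f), mul_comm]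
  rw [LinearMap.mem_ker] at hv
  rw [hδ, hδ, hV, hV, hv, hδx, diagMap_ofV, diagMap_ofV, zero_mul, mul_zero, zero_add, add_zero,
    diagMap_ofV, single_eq, mul_assoc, w_mul_ofV, ← mul_assoc, ← mul_assoc, ← ofS_ι, ← ofS_ι,
    ← map_mul (ofS r f), ← map_mul (ofS r f), ← single_eq, ← single_eq, mul_comm P] at h1
  exact ι_injective_of_field (mul_right_cancel₀ (ne_zero_of_notMem_ker hx hδx)
    (single_injective _ h1))

theorem IsSkewDerivation.rel_w
    (hδ : IsSkewDerivation (diagMap r f φ χ) (diagMap r f ψ χ') δ)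
    (hV : ∀ v, δ (ofV r f v) = δ' v) (hw : ∀ g, δ (w r f g) = 0) (g : G) (v : V) :
    δ' (r g v) * ((χ' g : k) • w r f g) = (χ g : k) • w r f g * δ' v := by
  have h1 := congrArg δ (w_mul_ofV (r := r) (f := f) g v)
  rw [hδ, hδ, hw, hV, hV, diagMap_w, diagMap_w, zero_mul, mul_zero, zero_add, add_zero] at h1
  exact h1.symm

/-- The element w_g is invertible up to a scalar, so it can be removed from δ'(ᵍv)w_g = 0. -/
theorem rep_mem_ker_of_rel
    (hrel : ∀ g v, δ' (r g v) * ((χ' g : k) • w r f g) = (χ g : k) • w r f g * δ' v)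
    (g : G) {v : V} (hv : v ∈ LinearMap.ker δ') : r g v ∈ LinearMap.ker δ' := by
  rw [LinearMap.mem_ker] at hv ⊢
  have h1 := congrArg (· * w r f g⁻¹) (hrel g v)
  simp only [hv, mul_zero, zero_mul, mul_smul_comm, smul_mul_assoc, mul_assoc, w_mul_w,
    mul_inv_cancel, w_one, mul_one, smul_eq_zero, Units.ne_zero, false_or] at h1
  exact h1

theorem smul_w_mul_single (g : G) (c : k) :
    c • w r f g * single r f g₀ P = (c * f g g₀) • single r f (g * g₀) (symMap (r g) P) := by
  rw [smul_mul_assoc, w, single_mul_single, one_mul, smul_smul]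

theorem single_mul_smul_w (g : G) (c : k) :
    single r f g₀ P * (c • w r f g) = (c * f g₀ g) • single r f (g₀ * g) P := by
  rw [mul_smul_comm, w, single_mul_single, map_one, mul_one, smul_smul]

/-- At v = x the relation equates a nonzero multiple of ᵍP w_{gg₀} with a multiple of P w_{g₀g}. As
P ≠ 0, the basis indices agree, which is centrality, and then so do the coefficients. -/
theorem center_and_rep_of_rel (hx : x ∉ LinearMap.ker δ') (hδx : δ' x = single r f g₀ P)
    (hrel : ∀ g v, δ' (r g v) * ((χ' g : k) • w r f g) = (χ g : k) • w r f g * δ' v)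
    {lam : G → k} (hlam : ∀ g, r g x - lam g • x ∈ LinearMap.ker δ') :
    g₀ ∈ Subgroup.center G ∧ ∀ g, symMap (r g) P =
      (lam g * (((χ g)⁻¹ * χ' g * (f g g₀)⁻¹ * f g₀ g : kˣ) : k)) • P := by
  have hP := ne_zero_of_notMem_ker hx hδx
  have h1 : ∀ g, g * g₀ = g₀ * g ∧ ((χ g : k) * f g g₀) • symMap (r g) P =
      (lam g * (χ' g * f g₀ g : k)) • P := by
    intro g
    have h := hlam g
    rw [LinearMap.mem_ker, map_sub, map_smul, hδx, sub_eq_zero] at h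
    have h2 := hrel g x
    rw [h, hδx, smul_w_mul_single, smul_mul_assoc, single_mul_smul_w, smul_smul, ← map_smul,
      ← map_smul] at h2
    refine eq_of_single_eq_single (smul_ne_zero (by simp) ?_) h2.symm
    exact (map_ne_zero_iff _ (symMap_rep_injective g)).mpr hP
  refine ⟨Subgroup.mem_center_iff.mpr fun g => (h1 g).1, fun g => ?_⟩
  have h2 := congrArg (fun z => ((χ g : k) * f g g₀)⁻¹ • z) (h1 g).2
  simp only [smul_smul] at h2
  rw [inv_mul_cancel₀ (by simp), one_smul] at h2
  rw [h2]
  congr 1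
  push_cast
  field_simp

theorem rel_of_center_and_rep (hcodim : Module.finrank k (V ⧸ LinearMap.ker δ') = 1)
    (hx : x ∉ LinearMap.ker δ') (hδx : δ' x = single r f g₀ P)
    {lam : G → k} (hlam : ∀ g, r g x - lam g • x ∈ LinearMap.ker δ')
    (hg₀ : g₀ ∈ Subgroup.center G) (hker : ∀ g, ∀ v ∈ LinearMap.ker δ', r g v ∈ LinearMap.ker δ')
    (hP : ∀ g, symMap (r g) P =
      (lam g * (((χ g)⁻¹ * χ' g * (f g g₀)⁻¹ * f g₀ g : kˣ) : k)) • P) (g : G) (v : V) :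
    δ' (r g v) * ((χ' g : k) • w r f g) = (χ g : k) • w r f g * δ' v := by
  obtain ⟨c, hc⟩ := exists_sub_smul_mem_ker hcodim hx v
  have h1 := hker g _ hc
  have h := hlam g
  rw [LinearMap.mem_ker, map_sub, map_smul, sub_eq_zero] at h hc
  rw [LinearMap.mem_ker, map_sub, map_smul, map_sub, map_smul, sub_eq_zero] at h1
  rw [hc, h1, h, hδx, smul_mul_assoc, smul_mul_assoc, mul_smul_comm c, smul_w_mul_single,
    single_mul_smul_w, hP, map_smul, smul_smul, smul_smul, smul_smul, smul_smul,
    Subgroup.mem_center_iff.mp hg₀ g]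
  congr 1
  push_cast
  field_simp

theorem map_ker_eq [FiniteDimensional k V] (φ : V ≃ₗ[k] V)
    (h : ∀ v ∈ LinearMap.ker δ', φ v ∈ LinearMap.ker δ') :
    (LinearMap.ker δ').map φ.toLinearMap = LinearMap.ker δ' := by
  refine Submodule.eq_of_le_of_finrank_eq (Submodule.map_le_iff_le_comap.mpr h) ?_
  exact LinearEquiv.finrank_map_eq φ _

theorem apply_eq_smul_of_sub_mem_ker {y : V} {c : k} (h : y - c • x ∈ LinearMap.ker δ') :
    δ' y = c • δ' x := by
  rwa [LinearMap.mem_ker, map_sub, map_smul, sub_eq_zero] at h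

end CrossedProduct

end

noncomputable section

/-! ### The action of `σ` and the twist conditions -/

namespace CrossedProduct

open SymmetricAlgebra

variable {k G V : Type*} [Field k] [Group G] [AddCommGroup V] [Module k V]
  {r : Representation k G V} {f : NormalCocycle G k}

theorem eq_diagMap_of_mul {ς : Module.End k (CrossedProduct r f)} {φ : V →ₗ[k] V} {χ : G → kˣ}
    (hmul : ∀ a b, ς (a * b) = ς a * ς b) (hone : ς 1 = 1)
    (hV : ∀ v, ς (ofV r f v) = ofV r f (φ v)) (hw : ∀ g, ς (w r f g) = (χ g : k) • w r f g) :
    ς = diagMap r f φ χ := by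
  have hS : ∀ P, ς (ofS r f P) = ofS r f (symMap φ P) := by
    intro P
    induction P using SymmetricAlgebra.induction with
    | algebraMap c =>
      simp only [Algebra.algebraMap_eq_smul_one, map_smul, hone, map_one]
    | ι v => rw [ofS_ι, hV, symMap_ι, ofS_ι]
    | mul P Q hP hQ => rw [map_mul, hmul, hP, hQ, map_mul, map_mul]
    | add P Q hP hQ => simp only [map_add, hP, hQ]
  ext a
  induction a using induction_on with
  | zero => simp
  | add a b ha hb => simp only [map_add, ha, hb]
  | single g P => rw [diagMap_single, single_eq, hmul, hS, hw, single_eq, mul_smul_comm]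

/-- Multiplicativity on w_g w_h makes χ a homomorphism, hence χ(1) = 1; only then does the map
restrict to φ on `V`, and w_g v = ᵍv w_g yields equivariance. -/
theorem equivariant_of_diagMap_mul {φ : V →ₗ[k] V} {χ : G → kˣ}
    (hmul : ∀ a b, diagMap r f φ χ (a * b) = diagMap r f φ χ a * diagMap r f φ χ b) :
    (∀ g v, φ (r g v) = r g (φ v)) ∧ ∀ g h, χ (g * h) = χ g * χ h := by
  have hχ : ∀ g h, χ (g * h) = χ g * χ h := by
    intro g h
    have h1 := hmul (w r f g) (w r f h)
    rw [w_mul_w, map_smul, diagMap_w, diagMap_w, diagMap_w, smul_mul_assoc, mul_smul_comm, w_mul_w,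
      w, ← map_smul, ← map_smul, ← map_smul, ← map_smul, ← map_smul] at h1
    have h2 := single_injective _ h1
    rw [smul_smul, smul_smul, smul_smul, ← sub_eq_zero, ← sub_smul, smul_eq_zero,
      or_iff_left one_ne_zero, sub_eq_zero, mul_comm] at h2
    exact Units.ext (mul_right_cancel₀ (f g h).ne_zero (by simpa using h2))
  refine ⟨fun g v => ?_, hχ⟩
  have hχ1 : χ 1 = 1 := by simpa using hχ 1 1
  have hV : ∀ v, diagMap r f φ χ (ofV r f v) = ofV r f (φ v) := by
    intro v
    rw [← ofS_ι, ← single_one_eq, diagMap_single_one, hχ1, Units.val_one, one_smul,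
      AlgHom.comp_apply, symMap_ι]; rfl
  have h1 := congrArg (diagMap r f φ χ) (w_mul_ofV (r := r) (f := f) g v)
  rw [hmul, hmul, hV, hV, diagMap_w, smul_mul_assoc, w_mul_ofV, mul_smul_comm] at h1
  have h2 := smul_right_injective _ (χ g).ne_zero h1
  rw [← ofS_ι, ← ofS_ι, ← single_eq, ← single_eq] at h2
  exact (ι_injective_of_field (single_injective _ h2)).symm

section Main

variable {q : kˣ} {αhat : V ≃ₗ[k] V}
  {hαhat : ∀ g v, αhat (r g v) = r g (αhat v)} {χα : G →* kˣ}
  {δhat₁ δhat₂ : V →ₗ[k] CrossedProduct r f}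

theorem diagMap_comp_symm (φ : V →ₗ[k] V) (χ : G → kˣ) :
    diagMap r f φ χ ∘ₗ (diagAut f αhat hαhat χα).symm.toLinearMap =
      diagMap r f (φ ∘ₗ αhat.symm.toLinearMap) (χ * ⇑χα⁻¹) :=
  diagMap_comp φ αhat.symm.toLinearMap χ ⇑χα⁻¹

theorem action_sig_conditions [FiniteDimensional k V] {ςhat : V →ₗ[k] V} {χς : G → kˣ}
    {ρ : Hq q →ₐ[k] Module.End k (CrossedProduct r f)}
    (hρ : IsBraidedModuleAlgebra (goodTransposition q (diagAut f αhat hαhat χα)) ρ)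
    (hσV : ∀ v, ρ (Hq.sig q) (ofV r f v) = ofV r f (ςhat v))
    (hσw : ∀ g, ρ (Hq.sig q) (w r f g) = (χς g : k) • w r f g) :
    Function.Bijective ςhat ∧ (∀ g v, ςhat (r g v) = r g (ςhat v)) ∧
        (∀ g h, χς (g * h) = χς g * χς h) := by
  have hς := eq_diagMap_of_mul hρ.sig_mul hρ.sig_one hσV hσw
  have hinj : Function.Injective (ρ (Hq.sig q)) :=
    Function.LeftInverse.injective (g := ρ (Hq.sigInv q)) fun a => by
      rw [← Module.End.mul_apply, ← map_mul, Hq.sigInv_mul_sig, map_one ρ]; rfl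
  have hinj' : Function.Injective ςhat := fun u v huv =>
    ofV_injective (hinj (by rw [hσV, hσV, huv]))
  -- Finite dimension of `V` enters here: invertibility of `σ` only gives injectivity on `V`.
  refine ⟨⟨hinj', LinearMap.injective_iff_surjective.mp hinj'⟩, ?_⟩
  exact equivariant_of_diagMap_mul (r := r) (f := f) (fun a b => by rw [← hς]; exact hρ.sig_mul a b)

variable {ςhat : V →ₗ[k] V} {χς : G →* kˣ} {x₁ x₂ : V} {P₁ P₂ : SymmetricAlgebra k V} {g₁ g₂ : G}

theorem twist₂_iff (hα : (LinearMap.ker δhat₂).map αhat.toLinearMap = LinearMap.ker δhat₂) :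
    (∀ v ∈ LinearMap.ker δhat₂, ςhat v = r g₂ (αhat v)) ↔
      ∀ v ∈ LinearMap.ker δhat₂, (ςhat ∘ₗ αhat.symm.toLinearMap) v = r g₂ v := by
  constructor
  · intro H v hv
    rw [← hα] at hv
    obtain ⟨u, hu, rfl⟩ := hv
    simpa using H u hu
  · intro H v hv
    have : αhat v ∈ LinearMap.ker δhat₂ := by rw [← hα]; exact ⟨v, hv, rfl⟩
    simpa using H _ this

theorem twist₁_iff : (∀ v ∈ LinearMap.ker δhat₁, ςhat v = r g₁⁻¹ (αhat v)) ↔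
    ∀ v ∈ LinearMap.ker δhat₁, αhat v = r g₁ (ςhat v) := by
  have h1 : ∀ g v, r g (r g⁻¹ v) = v := fun g v => by
    rw [← Module.End.mul_apply, ← map_mul, mul_inv_cancel, map_one]; rfl
  constructor
  · intro H v hv
    rw [H v hv, h1]
  · intro H v hv
    rw [H v hv]
    simp

theorem smul_w_injective {g : G} {a b : CrossedProduct r f} (h : a * w r f g = b * w r f g) :
    a = b := by
  have h1 := congrArg (· * w r f g⁻¹) h
  simp only [mul_assoc, w_mul_w, mul_inv_cancel, w_one, mul_smul_comm, mul_one] at h1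
  exact smul_right_injective _ (f g g⁻¹).ne_zero h1

end Main

end CrossedProduct

end

noncomputable section

/-! ### Commutation relations between the operators -/

namespace CrossedProduct

open SymmetricAlgebra

variable {k G V : Type*} [Field k] [Group G] [AddCommGroup V] [Module k V]
  {r : Representation k G V} {f : NormalCocycle G k}

/-- Condition (9) concerns Pᵢ, whereas the operators produce Pᵢ w_{gᵢ}; the factor χ(g)⁻¹ makes up
for the scalar picked up by w_g. -/
theorem diagMap_single_eq_smul_iff {φ : V →ₗ[k] V} {χ : G →* kˣ} {g : G}
    {P : SymmetricAlgebra k V} {c : k} :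
    diagMap r f φ χ (single r f 1 P) = (c * (((χ g)⁻¹ : kˣ) : k)) • single r f 1 P ↔
      diagMap r f φ χ (single r f g P) = c • single r f g P := by
  rw [diagMap_single, diagMap_single, map_one, Units.val_one, one_smul, ← map_smul (single r f 1),
    ← map_smul (single r f g), ← map_smul (single r f g), (single_injective _).eq_iff,
    (single_injective _).eq_iff, mul_comm, mul_smul]
  constructor
  · intro h; rw [h, smul_smul]; simp
  · intro h; rw [← h, smul_smul]; simp

theorem IsSkewDerivation.commute_diagMap {φ ψ θ : V →ₗ[k] V} {χ χ' χθ : G →* kˣ}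
    {δ' : V →ₗ[k] CrossedProduct r f} {δ : Module.End k (CrossedProduct r f)} {x : V} {g₀ : G}
    {P : SymmetricAlgebra k V} {c : k}
    (hδ : IsSkewDerivation (diagMap r f φ χ) (diagMap r f ψ χ') δ)
    (hV : ∀ v, δ (ofV r f v) = δ' v) (hw : ∀ g, δ (w r f g) = 0)
    (hcodim : Module.finrank k (V ⧸ LinearMap.ker δ') = 1) (hx : x ∉ LinearMap.ker δ')
    (hδx : δ' x = single r f g₀ P)
    (hθ : ∀ g v, θ (r g v) = r g (θ v)) (hφθ : φ ∘ₗ θ = θ ∘ₗ φ) (hψθ : ψ ∘ₗ θ = θ ∘ₗ ψ)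
    (hker : ∀ v ∈ LinearMap.ker δ', θ v ∈ LinearMap.ker δ')
    (hθx : δ' (θ x) = c • diagMap r f θ χθ (single r f g₀ P)) (a : CrossedProduct r f) :
    δ (diagMap r f θ χθ a) = c • diagMap r f θ χθ (δ a) := by
  let β : CrossedProduct r f →ₐ[k] CrossedProduct r f :=
    AlgHom.ofLinearMap (diagMap r f θ χθ)
      (by rw [← w_one, diagMap_w, map_one, Units.val_one, one_smul]) (diagMap_mul hθ χθ)
  have hcomm : ∀ (φ : V →ₗ[k] V) (χ : G →* kˣ), φ ∘ₗ θ = θ ∘ₗ φ →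
      ∀ a, diagMap r f φ χ (β a) = β (diagMap r f φ χ a) := by
    intro φ χ h a
    change (diagMap r f φ χ ∘ₗ diagMap r f θ χθ) a = (diagMap r f θ χθ ∘ₗ diagMap r f φ χ) a
    rw [diagMap_comp, diagMap_comp, h, mul_comm]
  refine hδ.commute hw β c (hcomm φ χ hφθ) (hcomm ψ χ' hψθ) (fun v => ?_) (fun g => ?_) a
  · change δ (diagMap r f θ χθ _) = c • diagMap r f θ χθ _
    rw [diagMap_ofV, hV, hV]
    obtain ⟨d, hd⟩ := exists_sub_smul_mem_ker hcodim hx v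
    have h1 := hker _ hd
    rw [map_sub, map_smul] at h1
    rw [apply_eq_smul_of_sub_mem_ker hd, apply_eq_smul_of_sub_mem_ker h1, hδx, hθx, map_smul,
      smul_comm]
  · change δ (diagMap r f θ χθ _) = 0
    rw [diagMap_w, map_smul, hw, smul_zero]

theorem linearMap_eq_of_ker {N : Type*} [AddCommGroup N] [Module k N]
    {S T : V →ₗ[k] N} {δ₁ δ₂ : V →ₗ[k] CrossedProduct r f} {x : V}
    (hcodim : Module.finrank k (V ⧸ LinearMap.ker δ₁) = 1)
    (hx : x ∉ LinearMap.ker δ₁) (hx' : x ∈ LinearMap.ker δ₂)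
    (h₁ : ∀ v ∈ LinearMap.ker δ₁, S v = T v) (h₂ : ∀ v ∈ LinearMap.ker δ₂, S v = T v) : S = T := by
  ext v
  obtain ⟨c, hc⟩ := exists_sub_smul_mem_ker hcodim hx v
  have h := h₁ _ hc
  simp only [map_sub, map_smul, h₂ x hx'] at h
  exact sub_left_injective h

/-- Expanding both composites on xy, the cross terms are α(δ₂x)·δ₁y and q·ς(α⁻¹(δ₁x))·ς(δ₂y) on
either side. The same `q` appears both times, once from moving δ₁ past ς and once from moving δ₂
past it. -/
theorem skewDerivations_commute {α : CrossedProduct r f ≃ₐ[k] CrossedProduct r f}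
    {ς δ₁ δ₂ : Module.End k (CrossedProduct r f)} {q : kˣ}
    (h₁ : IsSkewDerivation α.toLinearMap ς δ₁)
    (h₂ : IsSkewDerivation (ς ∘ₗ α.symm.toLinearMap) LinearMap.id δ₂)
    (hw₁ : ∀ g, δ₁ (w r f g) = 0) (hw₂ : ∀ g, δ₂ (w r f g) = 0)
    (hα₁ : ∀ a, δ₁ (α a) = α (δ₁ a)) (hα₂ : ∀ a, δ₂ (α a) = α (δ₂ a))
    (hας : ∀ a, ς (α a) = α (ς a))
    (hς₁ : ∀ a, δ₁ (ς a) = (q : k) • ς (δ₁ a)) (hς₂ : ∀ a, δ₂ (ς a) = (q : k) • ς (δ₂ a))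
    (hV : ∀ v, δ₁ (δ₂ (ofV r f v)) = δ₂ (δ₁ (ofV r f v))) : δ₁ * δ₂ = δ₂ * δ₁ := by
  have hα₁' : ∀ a, δ₁ (α.symm a) = α.symm (δ₁ a) := fun a => by
    rw [AlgEquiv.eq_symm_apply, ← hα₁, AlgEquiv.apply_symm_apply]
  ext a
  change δ₁ (δ₂ a) = δ₂ (δ₁ a)
  induction a using induction_generators with
  | algebraMap c =>
    rw [Algebra.algebraMap_eq_smul_one, ← w_one, map_smul, map_smul, map_smul, map_smul, hw₁, hw₂,
      map_zero, map_zero]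
  | add x y hx hy => simp only [map_add, hx, hy]
  | w g => rw [hw₁, hw₂, map_zero, map_zero]
  | ofV v => exact hV v
  | mul x y hx hy =>
    have e₁ : ∀ x y, δ₁ (x * y) = δ₁ x * ς y + α x * δ₁ y := h₁
    have e₂ : ∀ x y, δ₂ (x * y) = δ₂ x * y + ς (α.symm x) * δ₂ y := h₂
    have e₃ : α (ς (α.symm x)) = ς x := by rw [← hας, AlgEquiv.apply_symm_apply]
    rw [e₂, e₁, map_add, map_add, e₁, e₁, e₂, e₂, hx, hy, hς₁, hς₂, hα₁', hα₂, e₃,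
      AlgEquiv.symm_apply_apply, smul_mul_assoc, mul_smul_comm]
    abel

end CrossedProduct

end

noncomputable section

/-! ### The two directions -/

namespace CrossedProduct

open SymmetricAlgebra

section

variable {k G V : Type*} [Field k] [Group G] [AddCommGroup V] [Module k V]
  {q : kˣ} {r : Representation k G V} {f : NormalCocycle G k}
  {αhat : V ≃ₗ[k] V} {hαhat : ∀ g v, αhat (r g v) = r g (αhat v)} {χα : G →* kˣ}
  {δhat₁ δhat₂ : V →ₗ[k] CrossedProduct r f} {ςhat : V →ₗ[k] V} {χς : G →* kˣ}
  {P₁ P₂ : SymmetricAlgebra k V} {g₁ g₂ : G} {x₁ x₂ : V}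
  {lam₁ lam₂ : G → k} {ω₁ ω₂ ν₁ ν₂ : k}

/-- Conditions (2) to (10) of the main theorem, for given maps `δ₁` and `δ₂`. -/
structure IsAdmissible (q : kˣ) (αhat : V ≃ₗ[k] V) (χα : G →* kˣ)
    (δhat₁ δhat₂ : V →ₗ[k] CrossedProduct r f) (ςhat : V →ₗ[k] V) (χς : G →* kˣ)
    (P₁ P₂ : SymmetricAlgebra k V) (g₁ g₂ : G) (lam₁ lam₂ : G → k) (ω₁ ω₂ ν₁ ν₂ : k)
    (δ₁ δ₂ : Module.End k (CrossedProduct r f)) : Prop where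
  twist₁ : ∀ v ∈ LinearMap.ker δhat₁, ςhat v = r g₁⁻¹ (αhat v)
  twist₂ : ∀ v ∈ LinearMap.ker δhat₂, ςhat v = r g₂ (αhat v)
  center₁ : g₁ ∈ Subgroup.center G
  center₂ : g₂ ∈ Subgroup.center G
  rep_ker₁ : ∀ g, ∀ v ∈ LinearMap.ker δhat₁, r g v ∈ LinearMap.ker δhat₁
  rep_ker₂ : ∀ g, ∀ v ∈ LinearMap.ker δhat₂, r g v ∈ LinearMap.ker δhat₂
  rep_P₁ : ∀ g, symMap (r g) P₁ =
    (lam₁ g * (((χα g)⁻¹ * χς g * (f g g₁)⁻¹ * f g₁ g : kˣ) : k)) • P₁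
  rep_P₂ : ∀ g, symMap (r g) P₂ =
    (lam₂ g * ((χα g * (χς g)⁻¹ * (f g g₂)⁻¹ * f g₂ g : kˣ) : k)) • P₂
  map_ker₁ : (LinearMap.ker δhat₁).map αhat.toLinearMap = LinearMap.ker δhat₁
  map_ker₂ : (LinearMap.ker δhat₂).map αhat.toLinearMap = LinearMap.ker δhat₂
  skew₁ : IsSkewExtension (diagMap r f αhat.toLinearMap χα) (diagMap r f ςhat χς) δhat₁ δ₁
  skew₂ : IsSkewExtension (diagMap r f (ςhat ∘ₗ αhat.symm.toLinearMap) (χς * χα⁻¹ : G →* kˣ))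
    (diagMap r f LinearMap.id (1 : G →* kˣ)) δhat₂ δ₂
  apply_P₁ : δ₂ (single r f 1 P₁) = 0
  apply_P₂ : δ₁ (single r f 1 P₂) = 0
  ς_P₁ : diagMap r f ςhat χς (single r f 1 P₁) =
    (((q⁻¹ : kˣ) : k) * ω₁ * (((χς g₁)⁻¹ : kˣ) : k)) • single r f 1 P₁
  ς_P₂ : diagMap r f ςhat χς (single r f 1 P₂) =
    (((q⁻¹ : kˣ) : k) * ω₂ * (((χς g₂)⁻¹ : kˣ) : k)) • single r f 1 P₂
  α_P₁ : diagMap r f αhat.toLinearMap χα (single r f 1 P₁) =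
    (ν₁ * (((χα g₁)⁻¹ : kˣ) : k)) • single r f 1 P₁
  α_P₂ : diagMap r f αhat.toLinearMap χα (single r f 1 P₂) =
    (ν₂ * (((χα g₂)⁻¹ : kˣ) : k)) • single r f 1 P₂
  nilpotent : ∀ l : ℕ, 0 < l → q ≠ 1 → q ^ l = 1 → δ₁ ^ l = 0 ∧ δ₂ ^ l = 0

theorem diagAut_comp_symm_eq :
    diagMap r f ςhat χς ∘ₗ (diagAut f αhat hαhat χα).symm.toLinearMap =
      diagMap r f (ςhat ∘ₗ αhat.symm.toLinearMap) (χς * χα⁻¹ : G →* kˣ) :=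
  diagMap_comp_symm _ _

/-- `H_q` imposes nilpotency only at the exact order of `q`, while (10) ranges over all multiples of
that order. -/
theorem pow_eq_zero_of_primitive {d : Module.End k (CrossedProduct r f)}
    (hd : ∀ l : ℕ, 2 ≤ l → IsPrimitiveRoot (q : k) l → d ^ l = 0) (l : ℕ) (hl : 0 < l) (hq : q ≠ 1)
    (hql : q ^ l = 1) : d ^ l = 0 := by
  have h0 : orderOf q ∣ l := orderOf_dvd_of_pow_eq_one hql
  have h1 : orderOf q ≠ 1 := fun h => hq (orderOf_eq_one_iff.mp h)
  have h2 : orderOf q ≠ 0 := fun h => by rw [h, zero_dvd_iff] at h0; omega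
  have h3 := hd (orderOf q) (by omega) (IsPrimitiveRoot.coe_units_iff.mpr (.orderOf q))
  exact pow_eq_zero_of_le (Nat.le_of_dvd hl h0) h3

theorem isAdmissible_of_action [FiniteDimensional k V]
    (hx₁ : x₁ ∉ LinearMap.ker δhat₁) (hx₂ : x₂ ∉ LinearMap.ker δhat₂)
    (hδx₁ : δhat₁ x₁ = single r f g₁ P₁) (hδx₂ : δhat₂ x₂ = single r f g₂ P₂)
    (hx₁' : x₁ ∈ LinearMap.ker δhat₂) (hx₂' : x₂ ∈ LinearMap.ker δhat₁)
    (hlam₁ : ∀ g, r g x₁ - lam₁ g • x₁ ∈ LinearMap.ker δhat₁)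
    (hlam₂ : ∀ g, r g x₂ - lam₂ g • x₂ ∈ LinearMap.ker δhat₂)
    (hω₁ : ςhat x₁ - ω₁ • x₁ ∈ LinearMap.ker δhat₁)
    (hω₂ : ςhat x₂ - ω₂ • x₂ ∈ LinearMap.ker δhat₂)
    (hν₁ : αhat x₁ - ν₁ • x₁ ∈ LinearMap.ker δhat₁)
    (hν₂ : αhat x₂ - ν₂ • x₂ ∈ LinearMap.ker δhat₂)
    {ρ : Hq q →ₐ[k] Module.End k (CrossedProduct r f)}
    (hρ : IsBraidedModuleAlgebra (goodTransposition q (diagAut f αhat hαhat χα)) ρ)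
    (hσ : ρ (Hq.sig q) = diagMap r f ςhat χς)
    (hV₁ : ∀ v, ρ (Hq.D₁ q) (ofV r f v) = δhat₁ v) (hV₂ : ∀ v, ρ (Hq.D₂ q) (ofV r f v) = δhat₂ v)
    (hw₁ : ∀ g, ρ (Hq.D₁ q) (w r f g) = 0) (hw₂ : ∀ g, ρ (Hq.D₂ q) (w r f g) = 0) :
    IsAdmissible q αhat χα δhat₁ δhat₂ ςhat χς P₁ P₂ g₁ g₂ lam₁ lam₂ ω₁ ω₂ ν₁ ν₂
      (ρ (Hq.D₁ q)) (ρ (Hq.D₂ q)) := by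
  have hd₁ : IsSkewDerivation (diagMap r f αhat.toLinearMap χα) (diagMap r f ςhat χς)
      (ρ (Hq.D₁ q)) := fun a b => by
    rw [hρ.D₁_mul, hσ]; rfl
  have hd₂ : IsSkewDerivation (diagMap r f (ςhat ∘ₗ αhat.symm.toLinearMap) (χς * χα⁻¹ : G →* kˣ))
      (diagMap r f LinearMap.id (1 : G →* kˣ)) (ρ (Hq.D₂ q)) := fun a b => by
    rw [hρ.D₂_mul, hσ, diagMap_id, ← diagAut_comp_symm_eq (hαhat := hαhat)]; rfl
  have hα : ∀ h a, diagMap r f αhat.toLinearMap χα (ρ h a) = ρ h (diagMap r f αhat.toLinearMap χα a) :=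
    hρ.map_action
  have hα₁ : ∀ v, diagMap r f αhat.toLinearMap χα (δhat₁ v) = δhat₁ (αhat v) := fun v => by
    rw [← hV₁, ← hV₁, hα, diagMap_ofV]; rfl
  have hα₂ : ∀ v, diagMap r f αhat.toLinearMap χα (δhat₂ v) = δhat₂ (αhat v) := fun v => by
    rw [← hV₂, ← hV₂, hα, diagMap_ofV]; rfl
  have hς : ∀ (d : Hq q) (_ : d * Hq.sig q = (q : k) • (Hq.sig q * d)) (v : V),
      diagMap r f ςhat χς (ρ d (ofV r f v)) = ((q⁻¹ : kˣ) : k) • ρ d (ofV r f (ςhat v)) := by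
    intro d hd v
    have h := congrArg (fun z => ρ z (ofV r f v)) hd
    simp only [map_mul, map_smul, LinearMap.smul_apply, Module.End.mul_apply, hσ, diagMap_ofV] at h
    rw [h, smul_smul]; simp
  have hm₁ := map_ker_eq (δ' := δhat₁) αhat fun v hv => by
    rw [LinearMap.mem_ker, ← hα₁, LinearMap.mem_ker.mp hv, map_zero]
  have hm₂ := map_ker_eq (δ' := δhat₂) αhat fun v hv => by
    rw [LinearMap.mem_ker, ← hα₂, LinearMap.mem_ker.mp hv, map_zero]
  have hr₁ := hd₁.rel_w hV₁ hw₁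
  have hr₂ := hd₂.rel_w hV₂ hw₂
  obtain ⟨hc₁, hp₁⟩ := center_and_rep_of_rel hx₁ hδx₁ hr₁ hlam₁
  obtain ⟨hc₂, hp₂⟩ := center_and_rep_of_rel hx₂ hδx₂ hr₂ hlam₂
  have hcomm : ∀ a, ρ (Hq.D₁ q) (ρ (Hq.D₂ q) a) = ρ (Hq.D₂ q) (ρ (Hq.D₁ q) a) := fun a => by
    rw [← Module.End.mul_apply, ← Module.End.mul_apply, ← map_mul, ← map_mul, Hq.D₁_mul_D₂]
  constructor
  · exact twist₁_iff.mpr fun v hv => hd₁.twist_of_mem_ker hV₁ hx₁ hδx₁ hv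
  · exact (twist₂_iff hm₂).mpr fun v hv => hd₂.twist_of_mem_ker hV₂ hx₂ hδx₂ hv
  · exact hc₁
  · exact hc₂
  · exact fun g v hv => rep_mem_ker_of_rel hr₁ g hv
  · exact fun g v hv => rep_mem_ker_of_rel hr₂ g hv
  · exact hp₁
  · intro g
    rw [hp₂]
    congr 3
    simp [mul_comm]
  · exact hm₁
  · exact hm₂
  · exact hd₁.isSkewExtension hV₁ hw₁
  · exact hd₂.isSkewExtension hV₂ hw₂
  -- Since δ₂(x₁) = 0, commutation gives 0 = δ₂(P₁ w_{g₁}) = δ₂(P₁)w_{g₁}.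
  · have h := hcomm (ofV r f x₁)
    rw [hV₁, hV₂, LinearMap.mem_ker.mp hx₁', map_zero, hδx₁, single_eq, hd₂, hw₂, mul_zero, add_zero,
      diagMap_id] at h
    exact smul_w_injective (h.symm.trans (zero_mul _).symm)
  · have h := hcomm (ofV r f x₂)
    rw [hV₁, hV₂, LinearMap.mem_ker.mp hx₂', map_zero, hδx₂, single_eq, hd₁, hw₁, mul_zero, add_zero,
      diagMap_w, mul_smul_comm, smul_eq_zero, or_iff_right (Units.ne_zero _)] at h
    exact smul_w_injective (h.trans (zero_mul _).symm)
  · rw [diagMap_single_eq_smul_iff, ← hδx₁, ← hV₁, hς _ (Hq.D₁_mul_sig q), hV₁,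
      apply_eq_smul_of_sub_mem_ker hω₁, smul_smul, hV₁]
  · rw [diagMap_single_eq_smul_iff, ← hδx₂, ← hV₂, hς _ (Hq.D₂_mul_sig q), hV₂,
      apply_eq_smul_of_sub_mem_ker hω₂, smul_smul, hV₂]
  · rw [diagMap_single_eq_smul_iff, ← hδx₁, hα₁, apply_eq_smul_of_sub_mem_ker hν₁]
  · rw [diagMap_single_eq_smul_iff, ← hδx₂, hα₂, apply_eq_smul_of_sub_mem_ker hν₂]
  · intro l hl hq hql
    exact ⟨pow_eq_zero_of_primitive (fun l hl hp => by rw [← map_pow, Hq.D₁_pow q hl hp, map_zero])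
        l hl hq hql,
      pow_eq_zero_of_primitive (fun l hl hp => by rw [← map_pow, Hq.D₂_pow q hl hp, map_zero])
        l hl hq hql⟩

theorem exists_action_of_isAdmissible
    (hcodim₁ : Module.finrank k (V ⧸ LinearMap.ker δhat₁) = 1)
    (hcodim₂ : Module.finrank k (V ⧸ LinearMap.ker δhat₂) = 1)
    (hx₁ : x₁ ∉ LinearMap.ker δhat₁) (hx₂ : x₂ ∉ LinearMap.ker δhat₂)
    (hδx₁ : δhat₁ x₁ = single r f g₁ P₁) (hδx₂ : δhat₂ x₂ = single r f g₂ P₂)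
    (hx₁' : x₁ ∈ LinearMap.ker δhat₂)
    (hlam₁ : ∀ g, r g x₁ - lam₁ g • x₁ ∈ LinearMap.ker δhat₁)
    (hlam₂ : ∀ g, r g x₂ - lam₂ g • x₂ ∈ LinearMap.ker δhat₂)
    (hω₁ : ςhat x₁ - ω₁ • x₁ ∈ LinearMap.ker δhat₁)
    (hω₂ : ςhat x₂ - ω₂ • x₂ ∈ LinearMap.ker δhat₂)
    (hν₁ : αhat x₁ - ν₁ • x₁ ∈ LinearMap.ker δhat₁)
    (hν₂ : αhat x₂ - ν₂ • x₂ ∈ LinearMap.ker δhat₂)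
    (hbij : Function.Bijective ςhat) (hςhat : ∀ g v, ςhat (r g v) = r g (ςhat v))
    {δ₁ δ₂ : Module.End k (CrossedProduct r f)}
    (H : IsAdmissible q αhat χα δhat₁ δhat₂ ςhat χς P₁ P₂ g₁ g₂ lam₁ lam₂ ω₁ ω₂ ν₁ ν₂ δ₁ δ₂) :
    ∃ ρ : Hq q →ₐ[k] Module.End k (CrossedProduct r f),
      IsBraidedModuleAlgebra (goodTransposition q (diagAut f αhat hαhat χα)) ρ ∧
      ρ (Hq.sig q) = diagMap r f ςhat χς ∧ ρ (Hq.D₁ q) = δ₁ ∧ ρ (Hq.D₂ q) = δ₂ := by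
  obtain ⟨ςe, rfl⟩ : ∃ ςe : V ≃ₗ[k] V, ςe.toLinearMap = ςhat :=
    ⟨LinearEquiv.ofBijective ςhat hbij, rfl⟩
  let α : CrossedProduct r f ≃ₐ[k] CrossedProduct r f := diagAut f αhat hαhat χα
  let ς : CrossedProduct r f ≃ₐ[k] CrossedProduct r f := diagAut f ςe hςhat χς
  have hαsymm : ∀ g v, αhat.symm (r g v) = r g (αhat.symm v) := fun g v => by
    rw [LinearEquiv.symm_apply_eq, hαhat, LinearEquiv.apply_symm_apply]
  have hαker₁ : ∀ v ∈ LinearMap.ker δhat₁, αhat v ∈ LinearMap.ker δhat₁ := fun v hv => by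
    rw [← H.map_ker₁]; exact ⟨v, hv, rfl⟩
  have hαker₂ : ∀ v ∈ LinearMap.ker δhat₂, αhat v ∈ LinearMap.ker δhat₂ := fun v hv => by
    rw [← H.map_ker₂]; exact ⟨v, hv, rfl⟩
  have hςker₁ : ∀ v ∈ LinearMap.ker δhat₁, ςe.toLinearMap v ∈ LinearMap.ker δhat₁ := fun v hv => by
    rw [H.twist₁ v hv]; exact H.rep_ker₁ _ _ (hαker₁ v hv)
  have hςker₂ : ∀ v ∈ LinearMap.ker δhat₂, ςe.toLinearMap v ∈ LinearMap.ker δhat₂ := fun v hv => by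
    rw [H.twist₂ v hv]; exact H.rep_ker₂ _ _ (hαker₂ v hv)
  -- On each kernel ς̂ is a group element times α̂, hence commutes with the equivariant map α̂; the
  -- two distinct hyperplanes together span `V`.
  have hςα : ςe.toLinearMap ∘ₗ αhat.toLinearMap = αhat.toLinearMap ∘ₗ ςe.toLinearMap :=
    linearMap_eq_of_ker hcodim₁ hx₁ hx₁'
      (fun v hv => by
        rw [LinearMap.comp_apply, LinearMap.comp_apply, H.twist₁ v hv]
        refine (H.twist₁ _ (hαker₁ v hv)).trans ?_
        exact (hαhat _ _).symm)
      (fun v hv => by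
        rw [LinearMap.comp_apply, LinearMap.comp_apply, H.twist₂ v hv]
        refine (H.twist₂ _ (hαker₂ v hv)).trans ?_
        exact (hαhat _ _).symm)
  have hςα' : ∀ v, ςe (αhat.symm v) = αhat.symm (ςe v) := fun v => by
    rw [LinearEquiv.eq_symm_apply]
    have := LinearMap.congr_fun hςα (αhat.symm v)
    simpa using this.symm
  have hφ₂ : ∀ g v, (ςe.toLinearMap ∘ₗ αhat.symm.toLinearMap) (r g v) =
      r g ((ςe.toLinearMap ∘ₗ αhat.symm.toLinearMap) v) := fun g v => by
    simp only [LinearMap.comp_apply, LinearEquiv.coe_coe, hαsymm]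
    exact hςhat _ _
  have hd₁ := H.skew₁.isSkewDerivation hαhat hςhat
    (rel_of_center_and_rep hcodim₁ hx₁ hδx₁ hlam₁ H.center₁ H.rep_ker₁ H.rep_P₁)
  have hd₂ := H.skew₂.isSkewDerivation hφ₂ (fun _ _ => rfl)
    (rel_of_center_and_rep hcodim₂ hx₂ hδx₂ hlam₂ H.center₂ H.rep_ker₂ fun g => by
      rw [H.rep_P₂]; congr 3; simp [mul_comm])
  have hV₁ := H.skew₁.apply_ofV
  have hV₂ := H.skew₂.apply_ofV
  have hw₁ := H.skew₁.apply_w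
  have hw₂ := H.skew₂.apply_w
  have hα₁ : ∀ a, δ₁ (α a) = α (δ₁ a) := fun a => by
    have := hd₁.commute_diagMap (χθ := χα) (c := 1) hV₁ hw₁ hcodim₁ hx₁ hδx₁ hαhat rfl hςα hαker₁
      (by rw [diagMap_single_eq_smul_iff.mp H.α_P₁, one_smul, ← hδx₁]
          exact apply_eq_smul_of_sub_mem_ker hν₁) a
    rwa [one_smul] at this
  have hα₂ : ∀ a, δ₂ (α a) = α (δ₂ a) := fun a => by
    have := hd₂.commute_diagMap (χθ := χα) (θ := αhat.toLinearMap) (c := 1) hV₂ hw₂ hcodim₂ hx₂ hδx₂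
      hαhat (by ext v; simp [hςα']) rfl hαker₂
      (by rw [diagMap_single_eq_smul_iff.mp H.α_P₂, one_smul, ← hδx₂]
          exact apply_eq_smul_of_sub_mem_ker hν₂) a
    rwa [one_smul] at this
  have hς₁ : ∀ a, δ₁ (ς a) = (q : k) • ς (δ₁ a) := fun a =>
    hd₁.commute_diagMap (χθ := χς) hV₁ hw₁ hcodim₁ hx₁ hδx₁ hςhat hςα.symm rfl hςker₁
      (by rw [diagMap_single_eq_smul_iff.mp H.ς_P₁, smul_smul, ← hδx₁,
            apply_eq_smul_of_sub_mem_ker hω₁]; simp) a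
  have hς₂ : ∀ a, δ₂ (ς a) = (q : k) • ς (δ₂ a) := fun a =>
    hd₂.commute_diagMap (χθ := χς) (θ := ςe.toLinearMap) hV₂ hw₂ hcodim₂ hx₂ hδx₂ hςhat
      (by ext v; simp [hςα']) rfl hςker₂
      (by rw [diagMap_single_eq_smul_iff.mp H.ς_P₂, smul_smul, ← hδx₂,
            apply_eq_smul_of_sub_mem_ker hω₂]; simp) a
  have hας : ∀ a, ς (α a) = α (ς a) := fun a => by
    change (diagMap r f ςe.toLinearMap χς ∘ₗ diagMap r f αhat.toLinearMap χα) a =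
      (diagMap r f αhat.toLinearMap χα ∘ₗ diagMap r f ςe.toLinearMap χς) a
    rw [diagMap_comp, diagMap_comp, hςα, mul_comm]
  have hd₂' : IsSkewDerivation (ς.toLinearMap ∘ₗ α.symm.toLinearMap) LinearMap.id δ₂ := by
    rw [← diagMap_id (r := r) (f := f)]
    rw [← diagAut_comp_symm_eq (hαhat := hαhat)] at hd₂
    exact hd₂
  have hcomm : δ₁ * δ₂ = δ₂ * δ₁ := by
    refine skewDerivations_commute (α := α) (ς := ς.toLinearMap) hd₁ hd₂' hw₁ hw₂ hα₁ hα₂ hας hς₁ hς₂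
      fun v => ?_
    have h12 : δ₁ (δhat₂ x₂) = 0 := by
      rw [hδx₂, single_eq, hd₁, hw₁, ← single_one_eq, H.apply_P₂, zero_mul, mul_zero, add_zero]
    have h21 : δ₂ (δhat₁ x₁) = 0 := by
      rw [hδx₁, single_eq, hd₂, hw₂, ← single_one_eq, H.apply_P₁, zero_mul, mul_zero, add_zero]
    -- The map δ̂₂ has rank one with image spanned by its value at x₂, so the vanishing at x₂ is
    -- enough.
    have h12' : δ₁ ∘ₗ δhat₂ = 0 := by
      ext v
      obtain ⟨c, hc⟩ := exists_sub_smul_mem_ker hcodim₂ hx₂ v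
      rw [LinearMap.comp_apply, apply_eq_smul_of_sub_mem_ker hc, map_smul, h12, smul_zero]; rfl
    have h21' : δ₂ ∘ₗ δhat₁ = 0 := by
      ext v
      obtain ⟨c, hc⟩ := exists_sub_smul_mem_ker hcodim₁ hx₁ v
      rw [LinearMap.comp_apply, apply_eq_smul_of_sub_mem_ker hc, map_smul, h21, smul_zero]; rfl
    rw [hV₁, hV₂]
    exact (LinearMap.congr_fun h12' v).trans (LinearMap.congr_fun h21' v).symm
  have hnil : ∀ l : ℕ, 2 ≤ l → IsPrimitiveRoot (q : k) l → δ₁ ^ l = 0 ∧ δ₂ ^ l = 0 := by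
    intro l hl hq
    refine H.nilpotent l (by omega) (fun h => ?_) (Units.ext (by simpa using hq.pow_eq_one))
    rw [h, Units.val_one, IsPrimitiveRoot.one_left_iff] at hq
    omega
  let ρ : Hq q →ₐ[k] Module.End k (CrossedProduct r f) :=
    Hq.lift δ₁ δ₂ ς.toLinearMap ς.symm.toLinearMap hcomm
      (by ext a; exact ς.apply_symm_apply a) (by ext a; exact ς.symm_apply_apply a)
      (by ext a; exact hς₁ a) (by ext a; exact hς₂ a)
      (fun l hl hq => (hnil l hl hq).1) (fun l hl hq => (hnil l hl hq).2)
  have hρσ : ρ (Hq.sig q) = ς.toLinearMap := Hq.lift_sig ..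
  have hρτ : ρ (Hq.sigInv q) = ς.symm.toLinearMap := Hq.lift_sigInv ..
  have hρ₁ : ρ (Hq.D₁ q) = δ₁ := Hq.lift_D₁ ..
  have hρ₂ : ρ (Hq.D₂ q) = δ₂ := Hq.lift_D₂ ..
  refine ⟨ρ, ?_, hρσ, hρ₁, hρ₂⟩
  -- The operators commuting with `α` form a subalgebra, so the generators decide.
  have hαρ : ∀ h a, α (ρ h a) = ρ h (α a) := by
    intro h
    induction h using Hq.induction with
    | algebraMap c => intro a; simp [Module.algebraMap_end_apply]
    | add x y hx hy => intro a; simp only [map_add, LinearMap.add_apply, hx, hy]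
    | mul x y hx hy => intro a; simp only [map_mul, Module.End.mul_apply, hx, hy]
    | of x =>
      intro a
      cases x
      · rw [hρ₁, hα₁]
      · rw [hρ₂, hα₂]
      · rw [hρσ]; exact (hας a).symm
      · rw [hρτ]
        change α (ς.symm a) = ς.symm (α a)
        rw [AlgEquiv.eq_symm_apply, hας, AlgEquiv.apply_symm_apply]
  refine isBraidedModuleAlgebra_of_generators hαρ ?_ ?_ ?_ ?_ ?_ ?_
  · rw [hρσ]; exact map_mul ς
  · rw [hρσ, hρ₁]; exact hd₁
  · rw [hρσ, hρ₂]; exact hd₂'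
  · rw [hρσ]; exact map_one ς
  · rw [hρ₁]; exact hw₁ 1
  · rw [hρ₂]; exact hw₂ 1

end

end CrossedProduct
end

/-! ### The equivalence -/

theorem mainTheorem5 {k G V : Type*} [Field k] [Group G] [AddCommGroup V] [Module k V]
    [FiniteDimensional k V] (q : kˣ) (r : Representation k G V) (f : NormalCocycle G k)
    -- the data determining `α` and `s`
    (αhat : V ≃ₗ[k] V) (hαhat : ∀ g v, αhat (r g v) = r g (αhat v)) (χα : G →* kˣ)
    (δhat₁ δhat₂ : V →ₗ[k] CrossedProduct r f) (ςhat : V →ₗ[k] V) (χς : G → kˣ)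
    -- the standing assumptions on the maps `δhat₁`, `δhat₂`
    (hcodim₁ : Module.finrank k (V ⧸ LinearMap.ker δhat₁) = 1)
    (hcodim₂ : Module.finrank k (V ⧸ LinearMap.ker δhat₂) = 1)
    (hker : LinearMap.ker δhat₁ ≠ LinearMap.ker δhat₂)
    (P₁ P₂ : SymmetricAlgebra k V) (g₁ g₂ : G) (x₁ x₂ : V)
    (hx₁ : x₁ ∉ LinearMap.ker δhat₁) (hx₂ : x₂ ∉ LinearMap.ker δhat₂)
    (hδx₁ : δhat₁ x₁ = CrossedProduct.single r f g₁ P₁)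
    (hδx₂ : δhat₂ x₂ = CrossedProduct.single r f g₂ P₂)
    (hx₁' : x₁ ∈ LinearMap.ker δhat₂) (hx₂' : x₂ ∈ LinearMap.ker δhat₁)
    -- the scalars `λ_{ig}`, `ω_i`, `ν_i`
    (lam₁ lam₂ : G → k) (ω₁ ω₂ ν₁ ν₂ : k)
    (hlam₁ : ∀ g, r g x₁ - lam₁ g • x₁ ∈ LinearMap.ker δhat₁)
    (hlam₂ : ∀ g, r g x₂ - lam₂ g • x₂ ∈ LinearMap.ker δhat₂)
    (hω₁ : ςhat x₁ - ω₁ • x₁ ∈ LinearMap.ker δhat₁)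
    (hω₂ : ςhat x₂ - ω₂ • x₂ ∈ LinearMap.ker δhat₂)
    (hν₁ : αhat x₁ - ν₁ • x₁ ∈ LinearMap.ker δhat₁)
    (hν₂ : αhat x₂ - ν₂ • x₂ ∈ LinearMap.ker δhat₂) :
    let A := CrossedProduct r f
    let α : A ≃ₐ[k] A := CrossedProduct.diagAut f αhat hαhat χα
    let ς : A →ₗ[k] A := CrossedProduct.diagMap r f ςhat χς
    let IsDelta₁ : Module.End k A → Prop :=
      CrossedProduct.IsSkewExtension α.toLinearMap ς δhat₁
    let IsDelta₂ : Module.End k A → Prop :=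
      CrossedProduct.IsSkewExtension (ς ∘ₗ α.symm.toLinearMap) LinearMap.id δhat₂
    let item₂ : Prop :=
      (∀ v ∈ LinearMap.ker δhat₁, ςhat v = r g₁⁻¹ (αhat v)) ∧
        (∀ v ∈ LinearMap.ker δhat₂, ςhat v = r g₂ (αhat v))
    let item₇ : Prop :=
      (LinearMap.ker δhat₁).map αhat.toLinearMap = LinearMap.ker δhat₁ ∧
        (LinearMap.ker δhat₂).map αhat.toLinearMap = LinearMap.ker δhat₂
    -- the formulas for `δ₁`, `δ₂` in item (8) define maps as soon as items (2) and (7) hold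
    (item₂ → item₇ → (∃! δ₁, IsDelta₁ δ₁) ∧ (∃! δ₂, IsDelta₂ δ₂)) ∧
    ((∃ ρ : Hq q →ₐ[k] Module.End k A,
        IsBraidedModuleAlgebra (goodTransposition q α) ρ ∧
        (∀ v, ρ (Hq.sig q) (CrossedProduct.ofV r f v) = CrossedProduct.ofV r f (ςhat v)) ∧
        (∀ g, ρ (Hq.sig q) (CrossedProduct.w r f g) = (χς g : k) • CrossedProduct.w r f g) ∧
        (∀ v, ρ (Hq.D₁ q) (CrossedProduct.ofV r f v) = δhat₁ v) ∧
        (∀ v, ρ (Hq.D₂ q) (CrossedProduct.ofV r f v) = δhat₂ v) ∧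
        (∀ g, ρ (Hq.D₁ q) (CrossedProduct.w r f g) = 0) ∧
        (∀ g, ρ (Hq.D₂ q) (CrossedProduct.w r f g) = 0)) ↔
      -- (1)
      (Function.Bijective ςhat ∧ (∀ g v, ςhat (r g v) = r g (ςhat v)) ∧
        (∀ g h, χς (g * h) = χς g * χς h)) ∧
      -- (2)
      item₂ ∧
      -- (3)
      (g₁ ∈ Subgroup.center G ∧ g₂ ∈ Subgroup.center G) ∧
      -- (4)
      ((∀ g, ∀ v ∈ LinearMap.ker δhat₁, r g v ∈ LinearMap.ker δhat₁) ∧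
        (∀ g, ∀ v ∈ LinearMap.ker δhat₂, r g v ∈ LinearMap.ker δhat₂)) ∧
      -- (5)
      (∀ g, symMap (r g) P₁ =
        (lam₁ g * (((χα g)⁻¹ * χς g * (f g g₁)⁻¹ * f g₁ g : kˣ) : k)) • P₁) ∧
      -- (6)
      (∀ g, symMap (r g) P₂ =
        (lam₂ g * ((χα g * (χς g)⁻¹ * (f g g₂)⁻¹ * f g₂ g : kˣ) : k)) • P₂) ∧
      -- (7)
      item₇ ∧
      ∃ δ₁ δ₂ : Module.End k A, IsDelta₁ δ₁ ∧ IsDelta₂ δ₂ ∧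
        -- (8)
        (δ₂ (CrossedProduct.single r f 1 P₁) = 0 ∧ δ₁ (CrossedProduct.single r f 1 P₂) = 0) ∧
        -- (9)
        (ς (CrossedProduct.single r f 1 P₁) =
            (((q⁻¹ : kˣ) : k) * ω₁ * (((χς g₁)⁻¹ : kˣ) : k)) • CrossedProduct.single r f 1 P₁ ∧
          ς (CrossedProduct.single r f 1 P₂) =
            (((q⁻¹ : kˣ) : k) * ω₂ * (((χς g₂)⁻¹ : kˣ) : k)) • CrossedProduct.single r f 1 P₂ ∧
          α (CrossedProduct.single r f 1 P₁) =
            (ν₁ * (((χα g₁)⁻¹ : kˣ) : k)) • CrossedProduct.single r f 1 P₁ ∧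
          α (CrossedProduct.single r f 1 P₂) =
            (ν₂ * (((χα g₂)⁻¹ : kˣ) : k)) • CrossedProduct.single r f 1 P₂) ∧
        -- (10)
        (∀ l : ℕ, 0 < l → q ≠ 1 → q ^ l = 1 → δ₁ ^ l = 0 ∧ δ₂ ^ l = 0)) := by
  intro A α ς IsDelta₁ IsDelta₂ item₂ item₇
  have hid : (LinearMap.id : CrossedProduct r f →ₗ[k] CrossedProduct r f) =
    CrossedProduct.diagMap r f LinearMap.id (1 : G →* kˣ) := CrossedProduct.diagMap_id.symm
  -- The character stays a bare function here: the claim that the formulas define maps does not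
  -- assume (1).
  have hD₂ : IsDelta₂ = CrossedProduct.IsSkewExtension
      (CrossedProduct.diagMap r f (ςhat ∘ₗ αhat.symm.toLinearMap) (χς * ⇑χα⁻¹))
      (CrossedProduct.diagMap r f LinearMap.id (1 : G →* kˣ)) δhat₂ := by
    rw [← hid, ← CrossedProduct.diagMap_comp_symm (hαhat := hαhat)]
  refine ⟨fun h₂ h₇ => ⟨?_, ?_⟩, ?_⟩
  · exact CrossedProduct.exists_isSkewExtension_diagMap hcodim₁ hx₁ hδx₁
      (CrossedProduct.twist₁_iff.mp h₂.1)
  · rw [hD₂]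
    exact CrossedProduct.exists_isSkewExtension_diagMap hcodim₂ hx₂ hδx₂
      ((CrossedProduct.twist₂_iff h₇.2).mp h₂.2)
  constructor
  · rintro ⟨ρ, hρ, hσV, hσw, hV₁, hV₂, hw₁, hw₂⟩
    have h1 := CrossedProduct.action_sig_conditions hρ hσV hσw
    obtain ⟨χς, rfl⟩ : ∃ χ : G →* kˣ, ⇑χ = χς := ⟨MonoidHom.mk' χς h1.2.2, rfl⟩
    have H := CrossedProduct.isAdmissible_of_action hx₁ hx₂ hδx₁ hδx₂ hx₁' hx₂' hlam₁ hlam₂ hω₁ hω₂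
      hν₁ hν₂ hρ (CrossedProduct.eq_diagMap_of_mul hρ.sig_mul hρ.sig_one hσV hσw) hV₁ hV₂ hw₁ hw₂
    exact ⟨h1, ⟨H.twist₁, H.twist₂⟩, ⟨H.center₁, H.center₂⟩, ⟨H.rep_ker₁, H.rep_ker₂⟩, H.rep_P₁,
      H.rep_P₂, ⟨H.map_ker₁, H.map_ker₂⟩, _, _, H.skew₁, hD₂ ▸ H.skew₂, ⟨H.apply_P₁, H.apply_P₂⟩,
      ⟨H.ς_P₁, H.ς_P₂, H.α_P₁, H.α_P₂⟩, H.nilpotent⟩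
  · rintro ⟨h1, ⟨t₁, t₂⟩, ⟨c₁, c₂⟩, ⟨k₁, k₂⟩, p₁, p₂, ⟨m₁, m₂⟩, δ₁, δ₂, s₁, s₂, ⟨a₁, a₂⟩,
      ⟨b₁, b₂, b₃, b₄⟩, hn⟩
    obtain ⟨χς, rfl⟩ : ∃ χ : G →* kˣ, ⇑χ = χς := ⟨MonoidHom.mk' χς h1.2.2, rfl⟩
    rw [hD₂] at s₂
    obtain ⟨ρ, hρ, hσ, h₁, h₂⟩ := CrossedProduct.exists_action_of_isAdmissible (hαhat := hαhat)
      hcodim₁ hcodim₂ hx₁ hx₂ hδx₁ hδx₂ hx₁' hlam₁ hlam₂ hω₁ hω₂ hν₁ hν₂ h1.1 h1.2.1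
      ⟨t₁, t₂, c₁, c₂, k₁, k₂, p₁, p₂, m₁, m₂, s₁, s₂, a₁, a₂, b₁, b₂, b₃, b₄, hn⟩
    refine ⟨ρ, hρ, ?_, ?_, ?_, ?_, ?_, ?_⟩
    · rw [hσ]; exact CrossedProduct.diagMap_ofV _ _
    · rw [hσ]; exact CrossedProduct.diagMap_w _ _
    · rw [h₁]; exact CrossedProduct.IsSkewExtension.apply_ofV s₁
    · rw [h₂]; exact CrossedProduct.IsSkewExtension.apply_ofV (χ := χς * χα⁻¹) s₂
    · rw [h₁]; exact CrossedProduct.IsSkewExtension.apply_w s₁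
    · rw [h₂]; exact CrossedProduct.IsSkewExtension.apply_w s₂
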